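/- **Model.** There are $U$ users and $C$ creators with types $u_i, c_j\in\mathbb{R}^D_{\ge 0}$, $\|u_i\|_2=\|c_j\|_2=1$; user $i$ gets engagement $u_i^Tc_j$ from creator $j$. Fixed parameters are $K$ (number of recommendations per user), $\bar e\in[0,1]$ and $\bar a\in\mathbb{N}_0$. Let $\mathcal U_0,\mathcal C_0$ be the sets of all users and all creators. At each time $t=0,1,2,\dots$ the platform assigns to each $i\in\mathcal U_t$ a set $R_t(i)\subseteq\mathcal C_t$ of at most $K$ creators; then $$\mathcal U_{t+1}=\{i\in\mathcal U_t: |R_t(i)|=K,\ u_i^Tc_j\ge\bar e\ \ \forall j\in R_t(i)\},\qquad \mathcal C_{t+1}=\{j\in\mathcal C_t: |\{i\in\mathcal U_t: j\in R_t(i)\}|\ge\bar a\}.$$ The long-term engagement of $\mathbf R=(R_t)_{t\ge0}$ is $\mathcal E(\mathbf R)=\lim_{T\to\infty}\frac1T\sum_{t=0}^{T-1}\sum_{i\in\mathcal U_t}\sum_{j\in R_t(i)}u_i^Tc_j$ (the upper limit, should the limit not exist). A forward-looking sequence $\mathbf{FL}$ is one that maximizes $\mathcal E$. A user-centric sequence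 $\mathbf{UC}$ is one in which, at each $t$, each $i\in\mathcal U_t$ is assigned $\min\{K,|\mathcal C_t|\}$ creators maximizing $\sum_{j\in S}u_i^Tc_j$ over $S\subseteq\mathcal C_t$ with $|S|\le K$ (ties broken arbitrarily). **Theorem.** Let $C,K$ be fixed integers with $K\in(C/2,C)$ and let $\bar e\in[0,1]$ be arbitrary. For each integer $r\ge 0$ let $U=rC$, $\bar a=rK$, $D=2$, and let all types $u_i,c_j$ ($1\le i\le U$, $1\le j\le C$) be i.i.d. uniform on the set of non-negative unit vectors of $\mathbb{R}^2$. Put $\epsilon_r=\Pr(\mathcal E(\mathbf{FL})=0)$ and, when $\epsilon_r<1$, $$\rho_r=\mathbb E\left[\frac{\mathcal E(\mathbf{UC})}{\mathcal E(\mathbf{FL})}\ \middle|\ \mathcal E(\mathbf{FL})>0\right]$$ (this conditional expectation is then well defined); set $\rho_r=0$ if $\epsilon_r=1$. Let $X_1\le\dots\le X_C$ be the order statistics of $C$ i.i.d. $\mathrm{Uniform}(0,1)$ random variables, $X_0:=-\infty$, $X_{C+1}:=+\infty$, and $$S=\sum_{i=1}^{C-K+1}\Pr\left(\frac{X_i+X_{K+i}}2\ge\frac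 KC\ \text{ and }\ \frac{X_{i-1}+X_{K+i-1}}2\le1-\frac KC\right).$$ Then, as $r\to\infty$: 1. for every $\delta>0$, for all sufficiently large $r$ with $\epsilon_r<1$, $\ \rho_r\le\frac{1}{1-\epsilon_r}(S+\delta)$; 2. consequently, if $\epsilon:=\limsup_{r\to\infty}\epsilon_r<1$, then $\ \limsup_{r\to\infty}\rho_r\le\frac1{1-\epsilon}\,S$. Moreover, $$S=2^{K+1}\left(1-\tfrac KC\right)^C+\sum_{i=2}^{C-K}\frac{C!}{(i-2)!\,(K-2)!\,(C-K-i+1)!}\int_0^{\min\{1-\frac KC,\,3-\frac{4K}C\}}\int_{\max\{a,\frac{2K}C-1\}}^{2-\frac{2K}C-a}\int_b^{2-\frac{2K}C-a}a^{i-2}(c-b)^{K-2}\left(1-\max\{c,\tfrac{2K}C-b\}\right)^{C-K-i+1}\,dc\,db\,da,$$ where the integral over $a$ is zero if its upper limit is negative (i.e. if $K/C>3/4$), and $2^{K+1}(1-K/C)^C$ is the total of the two end terms $i=1$ and $i=C-K+1$ of $S$, which contribute $2^K(1-K/C)^C$ each. -/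

import Mathlib

open MeasureTheory ProbabilityTheory Filter Topology

noncomputable section

/-- Type vectors live in `D`-dimensional Euclidean space. -/
abbrev TypeSpace (D : ℕ) : Type := EuclideanSpace ℝ (Fin D)

/-- A type vector is a non-negative unit vector. -/
def IsTypeVector {D : ℕ} (x : TypeSpace D) : Prop :=
  (∀ k, 0 ≤ x k) ∧ ‖x‖ = 1

/-- The uniform distribution over the non-negative unit vectors: the surface measure of the unit
sphere, conditioned on the non-negative orthant, seen as a measure on the ambient space. -/
def uniformType (D : ℕ) : Measure (TypeSpace D) :=
  (ProbabilityTheory.cond (volume : Measure (TypeSpace D)).toSphere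
    {x : Metric.sphere (0 : TypeSpace D) 1 | ∀ k, 0 ≤ (x : TypeSpace D) k}).map Subtype.val

/-- Realizations of the types of `U` users (first component) and `C` creators (second one). -/
abbrev TypeSample (D U C : ℕ) : Type := (Fin U → TypeSpace D) × (Fin C → TypeSpace D)

/-- The joint law of `U` user types and `C` creator types that are all independent and uniform. -/
def typeLaw (D U C : ℕ) : Measure (TypeSample D U C) :=
  (Measure.pi fun _ : Fin U => uniformType D).prod (Measure.pi fun _ : Fin C => uniformType D)

/-- An instance of the recommendation problem: the number `K` of recommendations per user, the
audience size `abar` that a creator requires, the engagement `ebar` that a user requires from each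
recommended creator, and the types of the initial users and creators. -/
structure Platform (D U C : ℕ) where
  K : ℕ
  abar : ℕ
  ebar : ℝ
  types : TypeSample D U C

/-- A sequence of recommendations: at time `t`, user `i` is shown the creators in `R t i`.
(The value at a user who has left the platform plays no role.) -/
abbrev RecSeq (U C : ℕ) : Type := ℕ → Fin U → Finset (Fin C)

namespace Platform

variable {D U C : ℕ}

/-- All users and creators have type vectors. -/
def Valid (M : Platform D U C) : Prop :=
  (∀ i, IsTypeVector (M.types.1 i)) ∧ ∀ j, IsTypeVector (M.types.2 j)

/-- The engagement that user `i` obtains from creator `j`. -/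
def eng (M : Platform D U C) (i : Fin U) (j : Fin C) : ℝ :=
  inner ℝ (M.types.1 i) (M.types.2 j)

open Classical in
/-- The users and the creators that are on the platform at time `t`. -/
def state (M : Platform D U C) (R : RecSeq U C) : ℕ → Finset (Fin U) × Finset (Fin C)
  | 0 => (Finset.univ, Finset.univ)
  | t + 1 =>
    ((state M R t).1.filter fun i => (R t i).card = M.K ∧ ∀ j ∈ R t i, M.ebar ≤ M.eng i j,
     (state M R t).2.filter fun j =>
        M.abar ≤ ((state M R t).1.filter fun i => j ∈ R t i).card)

/-- The users on the platform at time `t`. -/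
def users (M : Platform D U C) (R : RecSeq U C) (t : ℕ) : Finset (Fin U) := (M.state R t).1

/-- The creators on the platform at time `t`. -/
def creators (M : Platform D U C) (R : RecSeq U C) (t : ℕ) : Finset (Fin C) := (M.state R t).2

/-- `R` only recommends creators that are still on the platform, and at most `K` to each user.
(A user with fewer than `K` recommendations leaves.) -/
def Feasible (M : Platform D U C) (R : RecSeq U C) : Prop :=
  ∀ t, ∀ i ∈ M.users R t, R t i ⊆ M.creators R t ∧ (R t i).card ≤ M.K

/-- The total engagement at time `t`. -/
def engagement (M : Platform D U C) (R : RecSeq U C) (t : ℕ) : ℝ :=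
  ∑ i ∈ M.users R t, ∑ j ∈ R t i, M.eng i j

/-- The long-term total engagement: the limit of the average engagement over the first `T` time
steps. The upper limit is used because, for sequences that keep switching between recommendations
forever, the limit need not exist. -/
def longTermEngagement (M : Platform D U C) (R : RecSeq U C) : ℝ :=
  limsup (fun T : ℕ => (1 / (T : ℝ)) * ∑ t ∈ Finset.range T, M.engagement R t) atTop

/-- `R` is a sequence of recommendations of the forward-looking algorithm: it maximizes the
long-term total engagement. -/
def IsForwardLooking (M : Platform D U C) (R : RecSeq U C) : Prop :=
  M.Feasible R ∧ ∀ R', M.Feasible R' → M.longTermEngagement R' ≤ M.longTermEngagement R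

/-- `R` is a sequence of recommendations of the user-centric algorithm: at each time step, each user
is shown the `K` remaining creators (all of them, if there are fewer than `K`) that give her the
greatest engagement. Ties may be broken in any way. -/
def IsUserCentric (M : Platform D U C) (R : RecSeq U C) : Prop :=
  ∀ t, ∀ i ∈ M.users R t,
    R t i ⊆ M.creators R t ∧
    (R t i).card = min M.K (M.creators R t).card ∧
    ∀ S ⊆ M.creators R t, S.card ≤ M.K → ∑ j ∈ S, M.eng i j ≤ ∑ j ∈ R t i, M.eng i j

end Platform

/-- The law of `n` independent random variables that are uniform on `[0, 1]`. -/
def uniformLaw (n : ℕ) : Measure (Fin n → ℝ) :=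
  Measure.pi fun _ => (volume : Measure ℝ).restrict (Set.Icc 0 1)

/-- The order statistics `X₁ ≤ ⋯ ≤ Xₙ` of `x`, with `X₀ = -∞` and `Xᵢ = +∞` for `i > n`. -/
def orderStat {n : ℕ} (x : Fin n → ℝ) (i : ℕ) : EReal :=
  if i = 0 then ⊥
  else if h : i - 1 < n then ((x (Tuple.sort x ⟨i - 1, h⟩) : ℝ) : EReal)
  else ⊤

/-- The sum over `1 ≤ i ≤ C - K + 1` of the probabilities that
`(X_i + X_{K+i}) / 2 ≥ K / C` and `(X_{i-1} + X_{K+i-1}) / 2 ≤ 1 - K / C`. -/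
def orderStatBound (C K : ℕ) : ℝ :=
  ∑ i ∈ Finset.Icc 1 (C - K + 1),
    (uniformLaw C).real
      {x | (((K : ℝ) / C : ℝ) : EReal) ≤ (orderStat x i + orderStat x (K + i)) / 2 ∧
        (orderStat x (i - 1) + orderStat x (K + i - 1)) / 2 ≤ ((1 - (K : ℝ) / C : ℝ) : EReal)}

/-- The explicit value of the term with index `i`, for `2 ≤ i ≤ C - K`.
An integral over an empty interval `Set.Icc` is zero. -/
def tripleIntegralTerm (C K i : ℕ) : ℝ :=
  (C.factorial : ℝ) /
      ((i - 2).factorial * (K - 2).factorial * (C - K - i + 1).factorial) *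
    ∫ a in Set.Icc (0 : ℝ) (min (1 - (K : ℝ) / C) (3 - 4 * (K : ℝ) / C)),
      ∫ b in Set.Icc (max a (2 * (K : ℝ) / C - 1)) (2 - 2 * (K : ℝ) / C - a),
        ∫ c in Set.Icc b (2 - 2 * (K : ℝ) / C - a),
          a ^ (i - 2) * (c - b) ^ (K - 2) *
            (1 - max c (2 * (K : ℝ) / C - b)) ^ (C - K - i + 1)

end

/-! A user-centric sequence is feasible, so the ratio of the two engagements lies in [0, 1], and its
conditional mean is at most P(E(UC) ≠ 0) / P(E(FL) > 0). It remains to bound P(E(UC) ≠ 0). If fewer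
than `K` creators survive the first step, then every user present at time 1 gets too few
recommendations, and nobody is left at time 2 (`IsUserCentric.longTermEngagement_eq_zero`). So E(UC)
≠ 0 forces `K` creators to pass the first audience test.

In the plane a type is an angle, uniform on [0, 1] after scaling, and engagement decreases with the
distance of angles. Hence each user is first shown the `K` nearest points on a line. Among `K + 1`
consecutive creators one is not shown, so the users who see the creator of rank a lie to the left of
the midpoint of X_a and X_{a+K}, and those who see the creator of rank b lie to the right of the
midpoint of X_{b-K} and X_b. If `K` creators survive, apply this to the survivors of extreme rank,
which are at least K - 1 ranks apart. Each needs rK of the rC users, a fraction K/C, so unless the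
empirical law of the users deviates by η from the uniform one, the two midpoint inequalities in the
definition of S hold up to η for some i (`IsUserCentric.exists_windowEvent`). Chebyshev's inequality
makes the deviation negligible as r grows, a union bound over i gives the sum, and η tends to 0 by
continuity from above (`eventually_exists_survival_event`).

The conditional expectation makes sense because both engagements are almost everywhere measurable,
although the sequences are arbitrary choices: E(FL) is a finite maximum over stable assignments, and
off a null set of ties E(UC) depends on the choice only through finitely many comparisons.

For the closed form, `prod_factorial_mul_uniformLaw` replaces an event about order statistics by one
about a vector sorted only between blocks. Once the few distinguished coordinates are fixed, that
event is a box, and iterated integrals remain. The two end terms reduce to a Beta integral and are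
exchanged by the reflection t ↦ 1 - t. -/

/-! ### Upper limits of averages -/

theorem limsup_average_eq {e : ℕ → ℝ} {B : ℝ} {N : ℕ} (h : ∀ t ≥ N, e t = B) :
    limsup (fun T : ℕ => (1 / (T : ℝ)) * ∑ t ∈ Finset.range T, e t) atTop = B := by
  have h1 : Tendsto e atTop (𝓝 B) :=
    tendsto_const_nhds.congr' (by
      filter_upwards [eventually_ge_atTop N] with t ht using (h t ht).symm)
  simpa only [one_div] using h1.cesaro.limsup_eq

theorem average_nonneg {e : ℕ → ℝ} (h0 : ∀ t, 0 ≤ e t) (T : ℕ) :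
    0 ≤ (1 / (T : ℝ)) * ∑ t ∈ Finset.range T, e t :=
  mul_nonneg (by positivity) (Finset.sum_nonneg fun t _ => h0 t)

/-- Replacing the tail by `B` gives a dominating sequence whose averages converge to `B`.
Nonnegativity supplies the coboundedness that comparing upper limits in ℝ requires. -/
theorem limsup_average_le {e : ℕ → ℝ} {B : ℝ} {N : ℕ} (h0 : ∀ t, 0 ≤ e t)
    (h : ∀ t ≥ N, e t ≤ B) :
    limsup (fun T : ℕ => (1 / (T : ℝ)) * ∑ t ∈ Finset.range T, e t) atTop ≤ B := by
  let f : ℕ → ℝ := fun t => if t < N then e t else B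
  have hf : ∀ t ≥ N, f t = B := fun t ht => if_neg (not_lt.2 ht)
  have hlim : Tendsto (fun T : ℕ => (1 / (T : ℝ)) * ∑ t ∈ Finset.range T, f t) atTop (𝓝 B) := by
    have h1 : Tendsto f atTop (𝓝 B) :=
      tendsto_const_nhds.congr' (by
        filter_upwards [eventually_ge_atTop N] with t ht using (hf t ht).symm)
    simpa only [one_div] using h1.cesaro
  rw [← hlim.limsup_eq]
  refine limsup_le_limsup (Eventually.of_forall fun T => ?_)
    (isCoboundedUnder_le_of_le atTop (x := 0) fun T => average_nonneg h0 T)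
    hlim.isBoundedUnder_le
  refine mul_le_mul_of_nonneg_left (Finset.sum_le_sum fun t _ => ?_) (by positivity)
  by_cases ht : t < N
  · simp [f, ht]
  · simpa [f, ht] using h t (not_lt.1 ht)

theorem limsup_average_nonneg {e : ℕ → ℝ} {B : ℝ} (h0 : ∀ t, 0 ≤ e t) (h : ∀ t, e t ≤ B) :
    0 ≤ limsup (fun T : ℕ => (1 / (T : ℝ)) * ∑ t ∈ Finset.range T, e t) atTop := by
  have hB : 0 ≤ B := (h0 0).trans (h 0)
  refine le_limsup_of_frequently_le (Frequently.of_forall fun T => average_nonneg h0 T) ?_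
  refine isBoundedUnder_of ⟨B, fun T => ?_⟩
  -- At T = 0 the factor 1 / T is 0 by convention.
  rcases Nat.eq_zero_or_pos T with rfl | hT
  · simpa using hB
  · have hT' : (0 : ℝ) < T := by exact_mod_cast hT
    rw [one_div, inv_mul_le_iff₀ hT']
    calc ∑ t ∈ Finset.range T, e t ≤ ∑ t ∈ Finset.range T, B := Finset.sum_le_sum fun t _ => h t
      _ = T * B := by simp

/-! ### Dynamics of the platform and stable assignments -/

namespace Platform

variable {D U C : ℕ} {M M' : Platform D U C} {R R' : RecSeq U C}

theorem users_zero : M.users R 0 = Finset.univ := rfl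

theorem creators_zero : M.creators R 0 = Finset.univ := rfl

theorem mem_users_succ {t : ℕ} {i : Fin U} :
    i ∈ M.users R (t + 1) ↔
      i ∈ M.users R t ∧ (R t i).card = M.K ∧ ∀ j ∈ R t i, M.ebar ≤ M.eng i j := by
  simp [users, state]

theorem mem_creators_succ {t : ℕ} {j : Fin C} :
    j ∈ M.creators R (t + 1) ↔
      j ∈ M.creators R t ∧ M.abar ≤ ((M.users R t).filter fun i => j ∈ R t i).card := by
  simp [users, creators, state]

theorem users_antitone : Antitone (M.users R) :=
  antitone_nat_of_succ_le fun _ _ hi => (mem_users_succ.1 hi).1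

theorem creators_antitone : Antitone (M.creators R) :=
  antitone_nat_of_succ_le fun _ _ hj => (mem_creators_succ.1 hj).1

/-- Both sets only shrink and are finite; in the order dual this is the stabilization of an
increasing chain. -/
theorem exists_state_eventually_const (M : Platform D U C) (R : RecSeq U C) :
    ∃ N, ∀ t ≥ N, M.users R t = M.users R N ∧ M.creators R t = M.creators R N := by
  let a : ℕ →o (Finset (Fin U) × Finset (Fin C))ᵒᵈ :=
    ⟨fun t => OrderDual.toDual (M.users R t, M.creators R t), fun s t h =>
      ⟨users_antitone h, creators_antitone h⟩⟩
  obtain ⟨N, hN⟩ := WellFoundedGT.monotone_chain_condition a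
  refine ⟨N, fun t ht => ?_⟩
  have h := (hN t ht).symm
  have h' : (M.users R t, M.creators R t) = (M.users R N, M.creators R N) := h
  exact Prod.ext_iff.1 h'

theorem Valid.eng_nonneg (h : M.Valid) (i : Fin U) (j : Fin C) : 0 ≤ M.eng i j := by
  simp only [eng, PiLp.inner_apply]
  exact Finset.sum_nonneg fun k _ => mul_nonneg ((h.2 j).1 k) ((h.1 i).1 k)

theorem Valid.eng_le_one (h : M.Valid) (i : Fin U) (j : Fin C) : M.eng i j ≤ 1 := by
  have := real_inner_le_norm (M.types.1 i) (M.types.2 j)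
  rwa [(h.1 i).2, (h.2 j).2, one_mul] at this

theorem Valid.engagement_nonneg (h : M.Valid) (R : RecSeq U C) (t : ℕ) : 0 ≤ M.engagement R t :=
  Finset.sum_nonneg fun i _ => Finset.sum_nonneg fun j _ => h.eng_nonneg i j

theorem Valid.engagement_le (h : M.Valid) (R : RecSeq U C) (t : ℕ) :
    M.engagement R t ≤ U * C := by
  calc M.engagement R t ≤ ∑ i : Fin U, ∑ j : Fin C, (1 : ℝ) := by
        refine (Finset.sum_le_sum fun i _ => ?_).trans
          (Finset.sum_le_sum_of_subset_of_nonneg (Finset.subset_univ _) fun i _ _ =>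
            Finset.sum_nonneg fun j _ => zero_le_one)
        exact (Finset.sum_le_sum fun j _ => h.eng_le_one i j).trans
          (Finset.sum_le_sum_of_subset_of_nonneg (Finset.subset_univ _) fun _ _ _ => zero_le_one)
    _ = U * C := by simp

theorem Valid.longTermEngagement_nonneg (h : M.Valid) (R : RecSeq U C) :
    0 ≤ M.longTermEngagement R :=
  limsup_average_nonneg (h.engagement_nonneg R) (h.engagement_le R)

theorem IsUserCentric.feasible (h : M.IsUserCentric R) : M.Feasible R := fun t i hi =>
  ⟨(h t i hi).1, (h t i hi).2.1.trans_le (min_le_left _ _)⟩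

/-- An assignment of creators to users that can be repeated forever. -/
def IsStable (M : Platform D U C) (A : Fin U → Finset (Fin C)) : Prop :=
  (∀ i, A i = ∅ ∨ ((A i).card = M.K ∧ ∀ j ∈ A i, M.ebar ≤ M.eng i j)) ∧
    ∀ i, ∀ j ∈ A i, M.abar ≤ (Finset.univ.filter fun i' => j ∈ A i').card

/-- The total engagement of an assignment. -/
noncomputable def value (M : Platform D U C) (A : Fin U → Finset (Fin C)) : ℝ :=
  ∑ i, ∑ j ∈ A i, M.eng i j

/-- The restriction of the recommendations at time `t` to the users that are present. -/
noncomputable def present (M : Platform D U C) (R : RecSeq U C) (t : ℕ) (i : Fin U) :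
    Finset (Fin C) := if i ∈ M.users R t then R t i else ∅

/-- The evaluating platform may differ from the one that runs: in `IsUserCentric.exists_limit` the
limiting assignment of one sample is valued with the types of another. -/
theorem value_present (M M' : Platform D U C) (R : RecSeq U C) (t : ℕ) :
    M'.value (M.present R t) = ∑ i ∈ M.users R t, ∑ j ∈ R t i, M'.eng i j := by
  have h : ∀ i, ∑ j ∈ M.present R t i, M'.eng i j =
      if i ∈ M.users R t then ∑ j ∈ R t i, M'.eng i j else 0 := by
    intro i; by_cases hi : i ∈ M.users R t <;> simp [present, hi]
  simp only [value, h, Finset.sum_ite_mem, Finset.univ_inter]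

/-- After one step exactly the users with a nonempty set remain, and they keep all creators in use
above the audience threshold. Positivity of `K` separates a user shown nothing, who leaves, from a
satisfied one. -/
theorem IsStable.feasible_const (hK : 0 < M.K) {A : Fin U → Finset (Fin C)} (hA : M.IsStable A) :
    M.Feasible (fun _ => A) ∧ M.longTermEngagement (fun _ => A) = M.value A := by
  have husers : ∀ t, M.users (fun _ => A) (t + 1) = Finset.univ.filter fun i => A i ≠ ∅ := by
    have key : ∀ i, ((A i).card = M.K ∧ ∀ j ∈ A i, M.ebar ≤ M.eng i j) ↔ A i ≠ ∅ := by
      intro i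
      constructor
      · rintro ⟨h, -⟩ h'
        rw [h', Finset.card_empty] at h; omega
      · intro h; exact (hA.1 i).resolve_left h
    intro t
    induction t with
    | zero => ext i; simp [mem_users_succ, users_zero, key]
    | succ t ih => ext i; rw [mem_users_succ, ih, key]; simp
  have hcre : ∀ t i, A i ⊆ M.creators (fun _ => A) t := by
    intro t
    induction t with
    | zero => intro i; simp [creators_zero]
    | succ t ih =>
      intro i j hj
      refine mem_creators_succ.2 ⟨ih i hj, (hA.2 i j hj).trans (Finset.card_le_card ?_)⟩
      intro i' hi'
      rw [Finset.mem_filter] at hi' ⊢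
      refine ⟨?_, hi'.2⟩
      cases t with
      | zero => simp [users_zero]
      | succ t => rw [husers]; simpa using Finset.ne_empty_of_mem hi'.2
  refine ⟨fun t i _ => ⟨hcre t i, ?_⟩, ?_⟩
  · rcases hA.1 i with h | h
    · simp [h]
    · exact h.1.le
  · refine limsup_average_eq (N := 1) fun t ht => ?_
    obtain ⟨s, rfl⟩ := Nat.exists_eq_add_of_le' ht
    rw [engagement, husers, Finset.sum_filter, value]
    refine Finset.sum_congr rfl fun i _ => ?_
    by_cases h : A i = ∅ <;> simp [h]

/-- Once the state is constant, everyone present survives the next step, and the survival conditions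
are precisely stability of the current recommendations. -/
theorem Feasible.exists_isStable (h : M.Feasible R) :
    ∃ N, ∀ t ≥ N, M.IsStable (M.present R t) ∧ M.engagement R t = M.value (M.present R t) := by
  obtain ⟨N, hN⟩ := M.exists_state_eventually_const R
  refine ⟨N, fun t ht => ⟨⟨fun i => ?_, fun i j hj => ?_⟩, (M.value_present M R t).symm⟩⟩
  · by_cases hi : i ∈ M.users R t
    · right
      have : i ∈ M.users R (t + 1) := by
        rwa [(hN (t + 1) (by omega)).1, ← (hN t ht).1]
      simpa [present, hi] using (mem_users_succ.1 this).2
    · left; simp [present, hi]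
  · by_cases hi : i ∈ M.users R t
    · have hj' : j ∈ M.creators R t := (h t i hi).1 (by simpa [present, hi] using hj)
      have : j ∈ M.creators R (t + 1) := by
        rwa [(hN (t + 1) (by omega)).2, ← (hN t ht).2]
      refine (mem_creators_succ.1 this).2.trans (Finset.card_le_card fun i' hi' => ?_)
      rw [Finset.mem_filter] at hi' ⊢
      exact ⟨Finset.mem_univ _, by simpa [present, hi'.1] using hi'.2⟩
    · simp [present, hi] at hj

open Classical in
/-- The greatest total engagement of a stable assignment. -/
noncomputable def optimum (M : Platform D U C) : ℝ :=
  (Finset.univ : Finset (Fin U → Finset (Fin C))).sup' Finset.univ_nonempty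
    fun A => if M.IsStable A then M.value A else 0

/-- A feasible sequence may switch between stable assignments forever, but from some time on each
single step is worth at most the best of them. -/
theorem Valid.longTermEngagement_le_optimum (hM : M.Valid) (h : M.Feasible R) :
    M.longTermEngagement R ≤ M.optimum := by
  obtain ⟨N, hN⟩ := h.exists_isStable
  refine limsup_average_le (N := N) (hM.engagement_nonneg R) fun t ht => ?_
  obtain ⟨h1, h2⟩ := hN t ht
  rw [h2, optimum]
  refine le_trans ?_ (Finset.le_sup' _ (Finset.mem_univ (M.present R t)))
  rw [if_pos h1]

/-- The bound is attained by repeating a best stable assignment. This expresses the engagement by a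
finite maximum, free of the choice of `R`, and so makes it measurable in the types. -/
theorem IsForwardLooking.longTermEngagement_eq (hM : M.Valid) (hK : 0 < M.K)
    (h : M.IsForwardLooking R) : M.longTermEngagement R = M.optimum := by
  refine le_antisymm (hM.longTermEngagement_le_optimum h.1) ?_
  refine Finset.sup'_le _ _ fun A _ => ?_
  split_ifs with hA
  · obtain ⟨h1, h2⟩ := hA.feasible_const hK
    exact h2 ▸ h.2 _ h1
  -- An unstable assignment counts as 0 in `optimum`, which is harmless since engagement is
  -- nonnegative.
  · exact hM.longTermEngagement_nonneg R

/-- Exchange argument: swapping `j` for `j'` gives an admissible competitor. -/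
theorem IsUserCentric.eng_le (h : M.IsUserCentric R) {t : ℕ} {i : Fin U} (hi : i ∈ M.users R t)
    {j j' : Fin C} (hj : j ∈ R t i) (hj' : j' ∈ M.creators R t) (hjR : j' ∉ R t i) :
    M.eng i j' ≤ M.eng i j := by
  obtain ⟨h1, h2, h3⟩ := h t i hi
  have h4 : j' ∉ (R t i).erase j := fun h => hjR (Finset.mem_of_mem_erase h)
  have h5 := h3 (insert j' ((R t i).erase j))
    (Finset.insert_subset hj' ((Finset.erase_subset _ _).trans h1)) (by
      rw [Finset.card_insert_of_notMem h4, Finset.card_erase_of_mem hj]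
      have := Finset.card_pos.2 ⟨j, hj⟩
      have := min_le_left M.K (M.creators R t).card
      omega)
  rw [Finset.sum_insert h4, ← Finset.add_sum_erase _ _ hj] at h5
  linarith

/-- Two platforms have the same parameters, the same order of the creators for each user, and the
same satisfied users. -/
def SameOrder (M M' : Platform D U C) : Prop :=
  M.K = M'.K ∧ M.abar = M'.abar ∧ (∀ i j j', M.eng i j ≤ M.eng i j' ↔ M'.eng i j ≤ M'.eng i j') ∧
    ∀ i j, M.ebar ≤ M.eng i j ↔ M'.ebar ≤ M'.eng i j

/-- Two distinct sets of equal size each contain an element missing from the other. The exchange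
inequality in both directions makes these two elements tie, against injectivity. -/
theorem IsUserCentric.rec_eq (h : M.IsUserCentric R) (h' : M'.IsUserCentric R')
    (hMM : M.SameOrder M') {i : Fin U} (hinj : Function.Injective (M.eng i)) {t t' : ℕ}
    (hi : i ∈ M.users R t) (hi' : i ∈ M'.users R' t')
    (hC : M.creators R t = M'.creators R' t') : R t i = R' t' i := by
  have hcard : (R t i).card = (R' t' i).card := by
    rw [(h t i hi).2.1, (h' t' i hi').2.1, hMM.1, hC]
  by_contra hne
  have h1 : ¬ R t i ⊆ R' t' i := fun hs => hne (Finset.eq_of_subset_of_card_le hs hcard.ge)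
  have h2 : ¬ R' t' i ⊆ R t i := fun hs => hne (Finset.eq_of_subset_of_card_le hs hcard.le).symm
  obtain ⟨j, hj, hj'⟩ := Finset.not_subset.1 h1
  obtain ⟨k, hk, hk'⟩ := Finset.not_subset.1 h2
  have h3 := h.eng_le hi hj (hC ▸ (h' t' i hi').1 hk) hk'
  have h4 := h'.eng_le hi' hk (hC ▸ (h t i hi).1 hj) hj'
  have h5 := hinj (le_antisymm h3 ((hMM.2.2.1 i j k).2 h4))
  exact hk' (h5 ▸ hj)

theorem IsUserCentric.state_eq (h : M.IsUserCentric R) (h' : M'.IsUserCentric R')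
    (hMM : M.SameOrder M') (hinj : ∀ i, Function.Injective (M.eng i)) (t : ℕ) :
    M.users R t = M'.users R' t ∧ M.creators R t = M'.creators R' t := by
  induction t with
  | zero => exact ⟨rfl, rfl⟩
  | succ t ih =>
    have hR : ∀ i ∈ M.users R t, R t i = R' t i := fun i hi =>
      h.rec_eq h' hMM (hinj i) hi (ih.1 ▸ hi) ih.2
    constructor
    · ext i
      rw [mem_users_succ, mem_users_succ, ← ih.1]
      refine and_congr_right fun hi => ?_
      rw [hR i hi, hMM.1]
      simp only [hMM.2.2.2]
    · ext j
      rw [mem_creators_succ, mem_creators_succ, ← ih.1, ← ih.2, hMM.2.1]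
      have : (M.users R t).filter (fun i => j ∈ R t i) =
          (M.users R t).filter (fun i => j ∈ R' t i) :=
        Finset.filter_congr fun i hi => by rw [hR i hi]
      rw [this]

/-- Without ties the whole run is determined by the comparisons, so all platforms with the same
comparisons settle on one assignment; their engagements differ only through its value. -/
theorem IsUserCentric.exists_limit (h : M.IsUserCentric R)
    (hinj : ∀ i, Function.Injective (M.eng i)) :
    ∃ A : Fin U → Finset (Fin C), ∀ (M' : Platform D U C) (R' : RecSeq U C), M.SameOrder M' →
      M'.IsUserCentric R' → M'.longTermEngagement R' = M'.value A := by
  obtain ⟨N, hN⟩ := M.exists_state_eventually_const R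
  refine ⟨M.present R N, fun M' R' hMM h' => ?_⟩
  refine limsup_average_eq (N := N) fun t ht => ?_
  obtain ⟨h1, h2⟩ := h.state_eq h' hMM hinj t
  obtain ⟨h3, h4⟩ := hN t ht
  rw [value_present, engagement, ← h1, h3]
  refine Finset.sum_congr rfl fun i hi => ?_
  rw [h.rec_eq h' hMM (hinj i) hi (t' := t) (by rwa [← h1, h3]) (by rw [← h2, h4])]

/-- At time 1 every remaining user receives fewer than `K` recommendations, so all are gone at time
2. -/
theorem IsUserCentric.longTermEngagement_eq_zero (h : M.IsUserCentric R)
    (hcard : (M.creators R 1).card < M.K) : M.longTermEngagement R = 0 := by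
  have h2 : M.users R 2 = ∅ := by
    refine Finset.eq_empty_of_forall_notMem fun i hi => ?_
    obtain ⟨h3, h4, -⟩ := mem_users_succ.1 hi
    rw [(h 1 i h3).2.1, min_eq_right hcard.le] at h4
    omega
  refine limsup_average_eq (N := 2) fun t ht => ?_
  have h3 : M.users R t = ∅ := Finset.subset_empty.1 (h2 ▸ users_antitone ht)
  rw [engagement, h3, Finset.sum_empty]

end Platform

/-! ### Angles of planar types and their uniform law -/

/-- The angle of a planar type vector, as a fraction of a right angle. -/
noncomputable def typeAngle (x : TypeSpace 2) : ℝ := 2 / Real.pi * Real.arccos (x 0)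

theorem measurable_typeAngle : Measurable typeAngle := by
  unfold typeAngle
  exact (Real.continuous_arccos.measurable.comp (by fun_prop)).const_mul _

theorem IsTypeVector.sq_add_sq {x : TypeSpace 2} (hx : IsTypeVector x) : x 0 ^ 2 + x 1 ^ 2 = 1 := by
  have h := hx.2
  rw [EuclideanSpace.norm_eq, Real.sqrt_eq_one] at h
  simpa using h

theorem IsTypeVector.typeAngle_mem {x : TypeSpace 2} (hx : IsTypeVector x) :
    typeAngle x ∈ Set.Icc (0 : ℝ) 1 := by
  have hpi := Real.pi_pos
  have h1 := Real.arccos_nonneg (x 0)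
  have h2 := Real.arccos_le_pi_div_two.2 (hx.1 0)
  constructor
  · unfold typeAngle; positivity
  · unfold typeAngle
    rw [div_mul_eq_mul_div, div_le_one hpi]
    linarith

theorem IsTypeVector.cos_typeAngle {x : TypeSpace 2} (hx : IsTypeVector x) :
    Real.cos (Real.pi / 2 * typeAngle x) = x 0 ∧ Real.sin (Real.pi / 2 * typeAngle x) = x 1 := by
  have hpi := Real.pi_pos
  have h0 : Real.pi / 2 * typeAngle x = Real.arccos (x 0) := by
    unfold typeAngle; field_simp
  have h := hx.sq_add_sq
  rw [h0, Real.cos_arccos (by linarith [hx.1 0]) (by nlinarith [hx.1 0, sq_nonneg (x 1)]),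
    Real.sin_arccos]
  refine ⟨rfl, ?_⟩
  rw [← h, add_sub_cancel_left, Real.sqrt_sq (hx.1 1)]

theorem inner_eq_cos_typeAngle {x y : TypeSpace 2} (hx : IsTypeVector x) (hy : IsTypeVector y) :
    inner ℝ x y = Real.cos (Real.pi / 2 * (typeAngle x - typeAngle y)) := by
  rw [mul_sub, Real.cos_sub, hx.cos_typeAngle.1, hx.cos_typeAngle.2, hy.cos_typeAngle.1,
    hy.cos_typeAngle.2]
  simp [PiLp.inner_apply, mul_comm]

/-- The cosine is strictly decreasing on [0, π]. Users thus rank creators by distance of angles,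
which makes the problem one-dimensional. -/
theorem inner_le_inner_iff {x y z : TypeSpace 2} (hx : IsTypeVector x) (hy : IsTypeVector y)
    (hz : IsTypeVector z) :
    (inner ℝ x y : ℝ) ≤ inner ℝ x z ↔
      |typeAngle x - typeAngle z| ≤ |typeAngle x - typeAngle y| := by
  have hpi := Real.pi_pos
  have key : ∀ w : TypeSpace 2, IsTypeVector w →
      Real.pi / 2 * |typeAngle x - typeAngle w| ∈ Set.Icc 0 Real.pi := by
    intro w hw
    have h1 := hx.typeAngle_mem
    have h2 := hw.typeAngle_mem
    have h3 : |typeAngle x - typeAngle w| ≤ 1 := by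
      rw [abs_le]; constructor <;> linarith [h1.1, h1.2, h2.1, h2.2]
    constructor
    · positivity
    · nlinarith
  have hcos : ∀ w : TypeSpace 2, IsTypeVector w →
      (inner ℝ x w : ℝ) = Real.cos (Real.pi / 2 * |typeAngle x - typeAngle w|) := by
    intro w hw
    rw [inner_eq_cos_typeAngle hx hw, ← Real.cos_abs, abs_mul, abs_of_pos (by positivity)]
  rw [hcos y hy, hcos z hz, Real.strictAntiOn_cos.le_iff_ge (key y hy) (key z hz)]
  exact mul_le_mul_iff_right₀ (by positivity)

/-- The planar sector of the points of the open unit disc with angle in `A`. -/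
def planarSector (A : Set ℝ) : Set (ℝ × ℝ) :=
  {p | √(p.1 ^ 2 + p.2 ^ 2) ∈ Set.Ioo (0 : ℝ) 1 ∧ 0 ≤ p.1 ∧ 0 ≤ p.2 ∧
    2 / Real.pi * Real.arccos (p.1 / √(p.1 ^ 2 + p.2 ^ 2)) ∈ A}

theorem measurableSet_planarSector {A : Set ℝ} (hA : MeasurableSet A) :
    MeasurableSet (planarSector A) := by
  have h1 : Measurable fun p : ℝ × ℝ => √(p.1 ^ 2 + p.2 ^ 2) := by fun_prop
  have h2 : Measurable fun p : ℝ × ℝ =>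
      2 / Real.pi * Real.arccos (p.1 / √(p.1 ^ 2 + p.2 ^ 2)) :=
    (Real.continuous_arccos.measurable.comp (measurable_fst.div h1)).const_mul _
  exact (h1 measurableSet_Ioo).inter
    ((measurable_fst measurableSet_Ici).inter
      ((measurable_snd measurableSet_Ici).inter (h2 hA)))

theorem polarCoord_symm_mem_planarSector (A : Set ℝ) {r θ : ℝ} (hr : 0 < r)
    (hθ : θ ∈ Set.Ioo (-Real.pi) Real.pi) :
    (r * Real.cos θ, r * Real.sin θ) ∈ planarSector A ↔
      r ∈ Set.Ioo (0 : ℝ) 1 ∧ θ ∈ Set.Icc 0 (Real.pi / 2) ∩ (fun θ => 2 / Real.pi * θ) ⁻¹' A := by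
  have hsq : √((r * Real.cos θ) ^ 2 + (r * Real.sin θ) ^ 2) = r := by
    have : (r * Real.cos θ) ^ 2 + (r * Real.sin θ) ^ 2 = r ^ 2 := by
      have := Real.cos_sq_add_sin_sq θ
      linear_combination r ^ 2 * this
    rw [this, Real.sqrt_sq hr.le]
  have hpos : (0 ≤ r * Real.cos θ ∧ 0 ≤ r * Real.sin θ) ↔ θ ∈ Set.Icc 0 (Real.pi / 2) := by
    rw [mul_nonneg_iff_of_pos_left hr, mul_nonneg_iff_of_pos_left hr]
    constructor
    · rintro ⟨h1, h2⟩
      constructor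
      · by_contra! h
        exact absurd (Real.sin_neg_of_neg_of_neg_pi_lt h hθ.1) (not_lt.2 h2)
      · by_contra! h
        exact absurd (Real.cos_neg_of_pi_div_two_lt_of_lt h (by linarith [hθ.2, Real.pi_pos]))
          (not_lt.2 h1)
    · rintro ⟨h1, h2⟩
      exact ⟨Real.cos_nonneg_of_neg_pi_div_two_le_of_le (by linarith [Real.pi_pos]) h2,
        Real.sin_nonneg_of_nonneg_of_le_pi h1 hθ.2.le⟩
  simp only [planarSector, Set.mem_ofPred_eq, hsq, mul_div_cancel_left₀ _ hr.ne', Set.mem_inter_iff,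
    Set.mem_preimage, ← hpos]
  rw [and_assoc]
  refine and_congr_right fun _ => ?_
  constructor
  · rintro ⟨h1, h2, h3⟩
    have := hpos.1 ⟨h1, h2⟩
    rw [Real.arccos_cos this.1 (by linarith [this.2, Real.pi_pos])] at h3
    exact ⟨h1, h2, h3⟩
  · rintro ⟨h1, h2, h3⟩
    have := hpos.1 ⟨h1, h2⟩
    rw [Real.arccos_cos this.1 (by linarith [this.2, Real.pi_pos])]
    exact ⟨h1, h2, h3⟩

theorem lintegral_ofReal_Ioo :
    ∫⁻ r in Set.Ioi (0 : ℝ), ENNReal.ofReal r * (Set.Ioo (0 : ℝ) 1).indicator 1 r =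
      ENNReal.ofReal (1 / 2) := by
  have h1 : ∀ r : ℝ, ENNReal.ofReal r * (Set.Ioo (0 : ℝ) 1).indicator 1 r =
      (Set.Ioo (0 : ℝ) 1).indicator (fun r => ENNReal.ofReal r) r := by
    intro r
    by_cases h : r ∈ Set.Ioo (0 : ℝ) 1 <;> simp [h]
  simp only [h1]
  rw [lintegral_indicator measurableSet_Ioo, Measure.restrict_restrict measurableSet_Ioo,
    Set.inter_eq_left.2 Set.Ioo_subset_Ioi_self, ← Measure.restrict_congr_set Ioo_ae_eq_Ioc.symm,
    ← ofReal_integral_eq_lintegral_ofReal, ← intervalIntegral.integral_of_le zero_le_one]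
  · simp
  · exact (intervalIntegrable_iff_integrableOn_Ioc_of_le zero_le_one).1
      (continuous_id.intervalIntegrable 0 1)
  · exact (ae_restrict_mem measurableSet_Ioc).mono fun x hx => hx.1.le

theorem volume_scaled_angles {A : Set ℝ} :
    volume (Set.Icc 0 (Real.pi / 2) ∩ (fun θ => 2 / Real.pi * θ) ⁻¹' A) =
      ENNReal.ofReal (Real.pi / 2) * volume (Set.Icc 0 1 ∩ A) := by
  have hpi := Real.pi_pos
  have : Set.Icc 0 (Real.pi / 2) ∩ (fun θ => 2 / Real.pi * θ) ⁻¹' A =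
      (fun θ => 2 / Real.pi * θ) ⁻¹' (Set.Icc 0 1 ∩ A) := by
    ext θ
    simp only [Set.mem_inter_iff, Set.mem_preimage, Set.mem_Icc]
    refine and_congr_left fun _ => ?_
    rw [mul_nonneg_iff_of_pos_left (by positivity), div_mul_eq_mul_div, div_le_one hpi,
      le_div_iff₀ (by norm_num), mul_comm θ]
  rw [this, Real.volume_preimage_mul_left (by positivity), abs_of_pos (by positivity), inv_div]

/-- In polar coordinates the indicator factors; the radial part contributes the integral of r over
(0, 1), and the angular part is a rescaled length. -/
theorem volume_planarSector {A : Set ℝ} (hA : MeasurableSet A) :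
    volume (planarSector A) =
      ENNReal.ofReal (1 / 2) * (ENNReal.ofReal (Real.pi / 2) * volume (Set.Icc 0 1 ∩ A)) := by
  have hpi := Real.pi_pos
  set B := Set.Icc 0 (Real.pi / 2) ∩ (fun θ => 2 / Real.pi * θ) ⁻¹' A with hB
  have hBm : MeasurableSet B := measurableSet_Icc.inter ((measurable_const_mul _) hA)
  have hBsub : B ⊆ Set.Ioo (-Real.pi) Real.pi := fun θ hθ =>
    ⟨by linarith [hθ.1.1], by linarith [hθ.1.2]⟩
  rw [← lintegral_indicator_one (measurableSet_planarSector hA),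
    ← lintegral_comp_polarCoord_symm, polarCoord_target]
  have h1 : ∀ p ∈ Set.Ioi (0 : ℝ) ×ˢ Set.Ioo (-Real.pi) Real.pi,
      ENNReal.ofReal p.1 • (planarSector A).indicator (1 : ℝ × ℝ → ENNReal) (polarCoord.symm p) =
        (ENNReal.ofReal p.1 * (Set.Ioo (0 : ℝ) 1).indicator 1 p.1) *
          B.indicator (1 : ℝ → ENNReal) p.2 := by
    rintro ⟨r, θ⟩ ⟨hr, hθ⟩
    have := polarCoord_symm_mem_planarSector A hr hθ
    rw [polarCoord_symm_apply, smul_eq_mul, mul_assoc]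
    congr 1
    by_cases h1 : r ∈ Set.Ioo (0 : ℝ) 1 <;> by_cases h2 : θ ∈ B
    · rw [Set.indicator_of_mem (this.2 ⟨h1, h2⟩)]; simp [h1, h2]
    · rw [Set.indicator_of_notMem (fun h => h2 (this.1 h).2)]; simp [h2]
    · rw [Set.indicator_of_notMem (fun h => h1 (this.1 h).1)]; simp [h1]
    · rw [Set.indicator_of_notMem (fun h => h1 (this.1 h).1)]; simp [h1]
  rw [setLIntegral_congr_fun (measurableSet_Ioi.prod measurableSet_Ioo) h1, Measure.volume_eq_prod,
    ← Measure.prod_restrict, lintegral_prod_mul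
      (f := fun r => ENNReal.ofReal r * (Set.Ioo (0 : ℝ) 1).indicator 1 r)
      (g := B.indicator 1), lintegral_ofReal_Ioo, lintegral_indicator_one hBm,
    Measure.restrict_apply hBm, Set.inter_eq_left.2 hBsub, hB, volume_scaled_angles]
  · exact (ENNReal.measurable_ofReal.mul
      (measurable_one.indicator measurableSet_Ioo)).aemeasurable
  · exact (measurable_one.indicator hBm).aemeasurable

theorem measurePreserving_coords :
    MeasurePreserving (fun y : TypeSpace 2 => (y 0, y 1)) volume volume :=
  (volume_preserving_finTwoArrow ℝ).comp (PiLp.volume_preserving_ofLp (Fin 2))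

open scoped Pointwise in
-- `Measure.toSphere` is the dimension times the volume of the cone over a set. Identifying that
-- cone with a sector reduces the surface measure to a planar volume.
theorem smul_image_sphere (A : Set ℝ) :
    Set.Ioo (0 : ℝ) 1 • (Subtype.val '' {x : Metric.sphere (0 : TypeSpace 2) 1 |
        (∀ k, 0 ≤ (x : TypeSpace 2) k) ∧ typeAngle x ∈ A}) =
      (fun y : TypeSpace 2 => (y 0, y 1)) ⁻¹' planarSector A := by
  have hnorm : ∀ y : TypeSpace 2, √(y 0 ^ 2 + y 1 ^ 2) = ‖y‖ := fun y => by
    simp [EuclideanSpace.norm_eq]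
  ext y
  simp only [Set.mem_smul, Set.mem_preimage, planarSector, Set.mem_ofPred_eq, hnorm]
  constructor
  · rintro ⟨r, hr, _, ⟨x, ⟨hx1, hx2⟩, rfl⟩, rfl⟩
    have hx : ‖(x : TypeSpace 2)‖ = 1 := by simp
    have hn : ‖r • (x : TypeSpace 2)‖ = r := by
      rw [norm_smul, hx, mul_one, Real.norm_of_nonneg hr.1.le]
    rw [hn]
    refine ⟨hr, mul_nonneg hr.1.le (hx1 0), mul_nonneg hr.1.le (hx1 1), ?_⟩
    simpa [mul_div_cancel_left₀ _ hr.1.ne', typeAngle] using hx2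
  · rintro ⟨h1, h2, h3, h4⟩
    have hn : ‖‖y‖⁻¹ • y‖ = 1 := by
      rw [norm_smul, norm_inv, norm_norm, inv_mul_cancel₀ h1.1.ne']
    refine ⟨‖y‖, h1, ‖y‖⁻¹ • y, ⟨⟨‖y‖⁻¹ • y, by simp [hn]⟩, ⟨fun k => ?_, ?_⟩, rfl⟩, ?_⟩
    · fin_cases k
      · exact mul_nonneg (inv_nonneg.2 h1.1.le) h2
      · exact mul_nonneg (inv_nonneg.2 h1.1.le) h3
    · simpa [typeAngle, div_eq_inv_mul] using h4
    · rw [smul_smul, mul_inv_cancel₀ h1.1.ne', one_smul]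

theorem measurableSet_orthant :
    MeasurableSet {x : Metric.sphere (0 : TypeSpace 2) 1 | ∀ k, 0 ≤ (x : TypeSpace 2) k} := by
  have : {x : Metric.sphere (0 : TypeSpace 2) 1 | ∀ k, 0 ≤ (x : TypeSpace 2) k} =
      ⋂ k, {x : Metric.sphere (0 : TypeSpace 2) 1 | 0 ≤ (x : TypeSpace 2) k} := by
    ext; simp
  rw [this]
  refine MeasurableSet.iInter fun k => measurableSet_le measurable_const ?_
  have : Measurable fun y : TypeSpace 2 => y k := by fun_prop
  exact this.comp measurable_subtype_coe

theorem toSphere_angles {A : Set ℝ} (hA : MeasurableSet A) :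
    (volume : Measure (TypeSpace 2)).toSphere {x : Metric.sphere (0 : TypeSpace 2) 1 |
        (∀ k, 0 ≤ (x : TypeSpace 2) k) ∧ typeAngle x ∈ A} =
      ENNReal.ofReal (Real.pi / 2) * volume (Set.Icc 0 1 ∩ A) := by
  rw [Measure.toSphere_apply', smul_image_sphere, measurePreserving_coords.measure_preimage
    (measurableSet_planarSector hA).nullMeasurableSet, volume_planarSector hA]
  · have : (Module.finrank ℝ (TypeSpace 2) : ENNReal) = ENNReal.ofReal 2 := by simp
    rw [this, ← mul_assoc, ← ENNReal.ofReal_mul (by norm_num)]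
    norm_num
  · exact measurableSet_orthant.inter ((measurable_typeAngle.comp measurable_subtype_coe) hA)

theorem toSphere_orthant :
    (volume : Measure (TypeSpace 2)).toSphere
      {x : Metric.sphere (0 : TypeSpace 2) 1 | ∀ k, 0 ≤ (x : TypeSpace 2) k} =
      ENNReal.ofReal (Real.pi / 2) := by
  have := toSphere_angles MeasurableSet.univ
  simpa using this

/-- The angle of a uniform type is uniform. -/
theorem map_typeAngle_uniformType :
    (uniformType 2).map typeAngle = (volume : Measure ℝ).restrict (Set.Icc 0 1) := by
  have hpi : 0 < Real.pi / 2 := by have := Real.pi_pos; positivity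
  ext A hA
  rw [uniformType, Measure.map_map measurable_typeAngle measurable_subtype_coe,
    Measure.map_apply (measurable_typeAngle.comp measurable_subtype_coe) hA,
    cond_apply measurableSet_orthant, toSphere_orthant]
  have := toSphere_angles hA
  have h2 : {x : Metric.sphere (0 : TypeSpace 2) 1 | ∀ k, 0 ≤ (x : TypeSpace 2) k} ∩
      typeAngle ∘ Subtype.val ⁻¹' A = {x : Metric.sphere (0 : TypeSpace 2) 1 |
        (∀ k, 0 ≤ (x : TypeSpace 2) k) ∧ typeAngle x ∈ A} := rfl
  rw [h2, this, ← mul_assoc, ENNReal.inv_mul_cancel (by simpa using hpi) ENNReal.ofReal_ne_top,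
    one_mul, Measure.restrict_apply hA, Set.inter_comm]

instance isProbabilityMeasure_uniformType : IsProbabilityMeasure (uniformType 2) := by
  have h : ((uniformType 2).map typeAngle) Set.univ = 1 := by
    rw [map_typeAngle_uniformType]; simp
  rw [Measure.map_apply measurable_typeAngle MeasurableSet.univ] at h
  exact ⟨h⟩

instance isProbabilityMeasure_unitInterval :
    IsProbabilityMeasure ((volume : Measure ℝ).restrict (Set.Icc 0 1)) := ⟨by simp⟩

instance isProbabilityMeasure_uniformLaw (n : ℕ) : IsProbabilityMeasure (uniformLaw n) := by
  unfold uniformLaw; infer_instance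

theorem ae_isTypeVector : ∀ᵐ x ∂uniformType 2, IsTypeVector x := by
  have hm : MeasurableSet {x : TypeSpace 2 | IsTypeVector x} := by
    have : {x : TypeSpace 2 | IsTypeVector x} = (⋂ k, {x | 0 ≤ x k}) ∩ {x | ‖x‖ = 1} := by
      ext; simp [IsTypeVector]
    rw [this]
    refine (MeasurableSet.iInter fun k => measurableSet_le measurable_const (by fun_prop)).inter ?_
    exact measurableSet_eq_fun measurable_norm measurable_const
  rw [uniformType, ae_map_iff measurable_subtype_coe.aemeasurable hm]
  filter_upwards [ae_cond_mem measurableSet_orthant] with x hx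
  exact ⟨hx, by simp⟩

theorem map_typeAngle_pi (n : ℕ) :
    (Measure.pi fun _ : Fin n => uniformType 2).map (fun x i => typeAngle (x i)) =
      uniformLaw n := by
  have h := map_typeAngle_uniformType
  have : ∀ _ : Fin n, SigmaFinite ((uniformType 2).map typeAngle) := fun _ => by
    rw [h]; infer_instance
  rw [Measure.pi_map_pi fun _ => measurable_typeAngle.aemeasurable]
  simp only [h, uniformLaw]

theorem measurePreserving_typeAngle (n : ℕ) :
    MeasurePreserving (fun (x : Fin n → TypeSpace 2) i => typeAngle (x i))
      (Measure.pi fun _ : Fin n => uniformType 2) (uniformLaw n) :=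
  ⟨measurable_pi_lambda _ fun i => measurable_typeAngle.comp (measurable_pi_apply i),
    map_typeAngle_pi n⟩

/-! ### Order statistics and vectors sorted between blocks -/

/-- The increasing rearrangement of a tuple. -/
noncomputable def sorted {n : ℕ} (x : Fin n → ℝ) : Fin n → ℝ := x ∘ Tuple.sort x

theorem monotone_sorted {n : ℕ} (x : Fin n → ℝ) : Monotone (sorted x) := Tuple.monotone_sort x

theorem sorted_eq_of_monotone {n : ℕ} {x : Fin n → ℝ} {σ : Equiv.Perm (Fin n)}
    (h : Monotone (x ∘ σ)) : sorted x = x ∘ σ :=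
  Tuple.unique_monotone (monotone_sorted x) h

theorem sorted_comp_perm {n : ℕ} (x : Fin n → ℝ) (σ : Equiv.Perm (Fin n)) :
    sorted (x ∘ σ) = sorted x :=
  Tuple.comp_perm_comp_sort_eq_comp_sort

/-- On the measurable set of vectors that a given σ makes monotone, sorting is the coordinate
permutation σ; these finitely many sets cover the space. -/
theorem measurable_sorted (n : ℕ) : Measurable (sorted : (Fin n → ℝ) → Fin n → ℝ) := by
  intro S hS
  have h : sorted ⁻¹' S = ⋃ σ : Equiv.Perm (Fin n),
      {x : Fin n → ℝ | Monotone (x ∘ σ)} ∩ (fun x => x ∘ σ) ⁻¹' S := by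
    ext x
    simp only [Set.mem_preimage, Set.mem_iUnion, Set.mem_inter_iff, Set.mem_ofPred_eq]
    constructor
    · exact fun hx => ⟨Tuple.sort x, monotone_sorted x, hx⟩
    · rintro ⟨σ, h1, h2⟩
      rwa [sorted_eq_of_monotone h1]
  rw [h]
  refine MeasurableSet.iUnion fun σ => MeasurableSet.inter ?_ ?_
  · have : {x : Fin n → ℝ | Monotone (x ∘ σ)} =
        ⋂ (i : Fin n) (j : Fin n) (_ : i ≤ j), {x | x (σ i) ≤ x (σ j)} := by
      ext x; simp [Monotone]
    rw [this]
    exact MeasurableSet.iInter fun i => MeasurableSet.iInter fun j => MeasurableSet.iInter fun _ =>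
      measurableSet_le (measurable_pi_apply _) (measurable_pi_apply _)
  · exact (measurable_pi_lambda _ fun i => measurable_pi_apply (σ i)) hS

theorem measurePreserving_comp_perm {n : ℕ} (σ : Equiv.Perm (Fin n)) :
    MeasurePreserving (fun x : Fin n → ℝ => x ∘ σ) (uniformLaw n) (uniformLaw n) := by
  have hm : Measurable (fun x : Fin n → ℝ => x ∘ σ) :=
    measurable_pi_lambda _ fun i => measurable_pi_apply (σ i)
  refine ⟨hm, (Measure.pi_eq fun s hs => ?_).symm⟩
  have : (fun x : Fin n → ℝ => x ∘ σ) ⁻¹' Set.univ.pi s = Set.univ.pi (s ∘ σ.symm) := by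
    ext x
    simp only [Set.mem_preimage, Set.mem_univ_pi, Function.comp_apply]
    exact ⟨fun h i => by simpa using h (σ.symm i), fun h i => by simpa using h (σ i)⟩
  rw [Measure.map_apply hm (MeasurableSet.univ_pi hs), this, uniformLaw, Measure.pi_pi]
  exact Equiv.prod_comp σ.symm fun i => (volume.restrict (Set.Icc 0 1)) (s i)

theorem uniformLaw_eq_restrict (n : ℕ) :
    uniformLaw n = (volume : Measure (Fin n → ℝ)).restrict (Set.univ.pi fun _ => Set.Icc 0 1) :=
  (Measure.restrict_pi_pi (fun _ : Fin n => (volume : Measure ℝ)) fun _ => Set.Icc 0 1).symm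

/-- Ties lie in finitely many proper subspaces, which are null. -/
theorem ae_injective_uniformLaw (n : ℕ) : ∀ᵐ x ∂uniformLaw n, Function.Injective x := by
  have key : ∀ i j : Fin n, i ≠ j → ∀ᵐ x ∂uniformLaw n, x i ≠ x j := by
    intro i j hij
    rw [uniformLaw_eq_restrict]
    refine ae_restrict_of_ae ?_
    let p : Submodule ℝ (Fin n → ℝ) :=
      LinearMap.ker (LinearMap.proj (R := ℝ) (φ := fun _ => ℝ) i - LinearMap.proj j)
    have hp : p ≠ ⊤ := by
      intro h
      have h1 : Pi.single i (1 : ℝ) ∈ p := h ▸ Submodule.mem_top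
      rw [LinearMap.mem_ker] at h1
      simp [hij.symm] at h1
    have h0 := Measure.addHaar_submodule (volume : Measure (Fin n → ℝ)) p hp
    rw [ae_iff]
    refine measure_mono_null (fun x hx => ?_) h0
    have hx' : x i = x j := by simpa using hx
    simp [p, hx']
  have : ∀ᵐ x ∂uniformLaw n, ∀ i j : Fin n, i ≠ j → x i ≠ x j :=
    ae_all_iff.2 fun i => ae_all_iff.2 fun j => by
      by_cases h : i = j
      · exact Eventually.of_forall fun _ h' => absurd h h'
      · filter_upwards [key i j h] with x hx _ using hx
  filter_upwards [this] with x hx i j h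
  by_contra hij
  exact hx i j hij h

/-- `y` is increasing from each level set of `f` to the next ones. -/
def BlockSorted {n : ℕ} {ι : Type*} [LinearOrder ι] (f : Fin n → ι) (y : Fin n → ℝ) : Prop :=
  ∀ j k, f j < f k → y j < y k

section Blocks

variable {n : ℕ} {ι : Type*} [LinearOrder ι] {f : Fin n → ι}

theorem measurableSet_blockSorted (f : Fin n → ι) : MeasurableSet {y | BlockSorted f y} := by
  have : {y | BlockSorted f y} = ⋂ (j : Fin n) (k : Fin n) (_ : f j < f k), {y | y j < y k} := by
    ext y; simp [BlockSorted]
  rw [this]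
  exact MeasurableSet.iInter fun i => MeasurableSet.iInter fun j => MeasurableSet.iInter fun _ =>
    measurableSet_lt (measurable_pi_apply _) (measurable_pi_apply _)

/-- If `z ∘ τ` is sorted between blocks, then `f ∘ τ.symm` is a monotone rearrangement of the
monotone `f`, hence equal to `f`: the permutation preserves every block. -/
theorem blockSorted_comp_iff (hf : Monotone f) {z : Fin n → ℝ} (hz : StrictMono z)
    (τ : Equiv.Perm (Fin n)) : BlockSorted f (z ∘ τ) ↔ f ∘ τ = f := by
  constructor
  · intro h
    have h1 : Monotone (f ∘ τ.symm) := by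
      intro a b hab
      by_contra! hlt
      have := h _ _ hlt
      simp only [Function.comp_apply, Equiv.apply_symm_apply] at this
      exact absurd (hz.lt_iff_lt.1 this) (not_lt.2 hab)
    have h2 : f ∘ τ.symm = f ∘ (Equiv.refl _) := Tuple.unique_monotone h1 hf
    funext i
    have := congrFun h2 (τ i)
    simpa using this.symm
  · intro h j k hjk
    refine hz ?_
    by_contra! hle
    have := hf hle
    have h1 := congrFun h j
    have h2 := congrFun h k
    simp only [Function.comp_apply] at h1 h2
    rw [h1, h2] at this
    exact absurd hjk (not_lt.2 this)

theorem strictMono_sorted {x : Fin n → ℝ} (hx : Function.Injective x) : StrictMono (sorted x) :=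
  (monotone_sorted x).strictMono_of_injective (hx.comp (Tuple.sort x).injective)

theorem BlockSorted.comp_sort (hf : Monotone f) {y : Fin n → ℝ} (hy : Function.Injective y)
    (h : BlockSorted f y) : f ∘ Tuple.sort y = f := by
  have h1 : y = sorted y ∘ (Tuple.sort y).symm := by
    funext i; simp [sorted]
  have h2 := (blockSorted_comp_iff hf (strictMono_sorted hy) (Tuple.sort y).symm).1 (h1 ▸ h)
  funext i
  have := congrFun h2 (Tuple.sort y i)
  simpa using this.symm

-- After translating by the sorting permutation, the set becomes the stabilizer of `f`, a product of
-- symmetric groups of the blocks.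
open Classical in
theorem card_blockSorted [Fintype ι] (hf : Monotone f) {x : Fin n → ℝ}
    (hx : Function.Injective x) :
    (Finset.univ.filter fun σ : Equiv.Perm (Fin n) => BlockSorted f (x ∘ σ)).card =
      ∏ i, (Fintype.card {a // f a = i}).factorial := by
  rw [← DomMulAct.stabilizer_card, ← Fintype.card_subtype]
  refine Fintype.card_congr ((Equiv.mulLeft (Tuple.sort x)⁻¹).subtypeEquiv fun σ => ?_)
  have : x ∘ σ = sorted x ∘ ((Tuple.sort x)⁻¹ * σ : Equiv.Perm (Fin n)) := by
    funext i; simp [sorted]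
  rw [this, blockSorted_comp_iff hf (strictMono_sorted hx)]
  rfl

/-- The probability of an event about order statistics, computed by the blocks of `f`. -/
theorem prod_factorial_mul_uniformLaw [Fintype ι] (hf : Monotone f) {P Q : Set (Fin n → ℝ)}
    (hP : MeasurableSet P) (hQ : MeasurableSet Q)
    (hPQ : ∀ y, Function.Injective y → BlockSorted f y → (sorted y ∈ P ↔ y ∈ Q)) :
    ((∏ i, (Fintype.card {a // f a = i}).factorial : ℕ) : ENNReal) *
        uniformLaw n {x | sorted x ∈ P} =
      n.factorial * uniformLaw n {y | BlockSorted f y ∧ y ∈ Q} := by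
  classical
  have hBQ : MeasurableSet {y | BlockSorted f y ∧ y ∈ Q} := (measurableSet_blockSorted f).inter hQ
  have hSP : MeasurableSet {x : Fin n → ℝ | sorted x ∈ P} := measurable_sorted n hP
  have h1 : ∀ σ : Equiv.Perm (Fin n),
      ∫⁻ x, {y | BlockSorted f y ∧ y ∈ Q}.indicator 1 (x ∘ σ) ∂uniformLaw n =
        uniformLaw n {y | BlockSorted f y ∧ y ∈ Q} := by
    intro σ
    rw [← lintegral_indicator_one hBQ]
    exact (measurePreserving_comp_perm σ).lintegral_comp (measurable_one.indicator hBQ)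
  -- Double counting: by exchangeability all n! rearrangements contribute equally, while for almost
  -- every `x` the sum counts the block-sorted rearrangements if the event on `sorted x` holds, and
  -- is 0 otherwise.
  have h2 : ∫⁻ x, ∑ σ : Equiv.Perm (Fin n),
      {y | BlockSorted f y ∧ y ∈ Q}.indicator (1 : (Fin n → ℝ) → ENNReal) (x ∘ σ) ∂uniformLaw n =
        n.factorial * uniformLaw n {y | BlockSorted f y ∧ y ∈ Q} := by
    have hm : ∀ σ ∈ (Finset.univ : Finset (Equiv.Perm (Fin n))), Measurable fun x =>
        {y | BlockSorted f y ∧ y ∈ Q}.indicator (1 : (Fin n → ℝ) → ENNReal) (x ∘ σ) := fun σ _ =>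
      (measurable_one.indicator hBQ).comp (measurePreserving_comp_perm σ).measurable
    rw [lintegral_finsetSum _ hm]
    simp [h1, Fintype.card_perm]
  rw [← h2, ← lintegral_indicator_one hSP,
    ← lintegral_const_mul _ (measurable_one.indicator hSP)]
  refine lintegral_congr_ae ?_
  filter_upwards [ae_injective_uniformLaw n] with x hx
  have h3 : ∀ σ : Equiv.Perm (Fin n),
      {y | BlockSorted f y ∧ y ∈ Q}.indicator (1 : (Fin n → ℝ) → ENNReal) (x ∘ σ) =
        (if BlockSorted f (x ∘ σ) then 1 else 0) *
          {x | sorted x ∈ P}.indicator (1 : (Fin n → ℝ) → ENNReal) x := by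
    intro σ
    by_cases hB : BlockSorted f (x ∘ σ)
    · have := hPQ (x ∘ σ) (hx.comp σ.injective) hB
      rw [sorted_comp_perm] at this
      by_cases hq : sorted x ∈ P
      · simp [Set.indicator, hB, hq, this.1 hq]
      · simp [Set.indicator, hB, hq, mt this.2 hq]
    · simp [Set.indicator, hB]
  simp only [h3]
  rw [← Finset.sum_mul, Finset.sum_boole, card_blockSorted hf hx]

end Blocks

/-! ### Iterated integrals and the Beta integral -/

/-- The uniform law on the unit interval. -/
noncomputable abbrev unitLaw : Measure ℝ := (volume : Measure ℝ).restrict (Set.Icc 0 1)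

section Marginals

variable {n : ℕ}

/-- The bound by 1 keeps the inner marginal finite, so the lower integral over the new coordinate
becomes a Bochner integral. -/
theorem toReal_lmarginal_insert {f : (Fin n → ℝ) → ENNReal} (hf : Measurable f) (hf1 : ∀ x, f x ≤ 1)
    {i : Fin n} {s : Finset (Fin n)} (hi : i ∉ s) (x : Fin n → ℝ) :
    ((∫⋯∫⁻_insert i s, f ∂fun _ => unitLaw) x).toReal =
      ∫ t, ((∫⋯∫⁻_s, f ∂fun _ => unitLaw) (Function.update x i t)).toReal ∂unitLaw := by
  rw [lmarginal_insert f hf hi, integral_toReal]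
  · exact ((hf.lmarginal fun _ => unitLaw).comp (measurable_update x)).aemeasurable
  · refine Eventually.of_forall fun t => ?_
    refine lt_of_le_of_lt ?_ ENNReal.one_lt_top
    calc _ ≤ ∫⁻ _ : (∀ _ : s, ℝ), 1 ∂Measure.pi fun _ : s => unitLaw :=
          lintegral_mono fun y => hf1 _
      _ = 1 := by simp

-- With the coordinates outside `s` frozen, the event is a box in the others. Taking `J j` to be
-- everything outside `s` gives those factors the value 1, so the product may run over all
-- coordinates.
open Classical in
theorem toReal_lmarginal_box {A : Set (Fin n → ℝ)} {s : Finset (Fin n)} {x : Fin n → ℝ}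
    {T : Prop} {J : Fin n → Set ℝ} (hJ : ∀ j, MeasurableSet (J j))
    (hu : ∀ j ∉ s, J j = Set.univ)
    (h : ∀ y : Fin n → ℝ, (∀ j ∉ s, y j = x j) → (y ∈ A ↔ T ∧ ∀ j ∈ s, y j ∈ J j)) :
    ((∫⋯∫⁻_s, A.indicator 1 ∂fun _ => unitLaw) x).toReal =
      if T then ∏ j, unitLaw.real (J j) else 0 := by
  have h1 : ∀ y : s → ℝ, A.indicator (1 : (Fin n → ℝ) → ENNReal) (Function.updateFinset x s y) =
      if T then (Set.univ.pi fun j : s => J j).indicator 1 y else 0 := by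
    intro y
    have h2 := h (Function.updateFinset x s y) fun j hj => by simp [Function.updateFinset, hj]
    have h3 : (∀ j ∈ s, Function.updateFinset x s y j ∈ J j) ↔
        y ∈ Set.univ.pi fun j : s => J j := by
      simp only [Set.mem_univ_pi, Subtype.forall]
      refine forall₂_congr fun j hj => ?_
      simp [Function.updateFinset, hj]
    rw [h3] at h2
    by_cases hT : T <;> by_cases hy : y ∈ Set.univ.pi fun j : s => J j
    · rw [Set.indicator_of_mem (h2.2 ⟨hT, hy⟩), if_pos hT, Set.indicator_of_mem hy]; rfl
    · rw [Set.indicator_of_notMem (fun h => hy (h2.1 h).2), if_pos hT, Set.indicator_of_notMem hy]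
    · rw [Set.indicator_of_notMem (fun h => hT (h2.1 h).1), if_neg hT]
    · rw [Set.indicator_of_notMem (fun h => hT (h2.1 h).1), if_neg hT]
  simp only [lmarginal, h1]
  by_cases hT : T
  · simp only [hT, if_true]
    rw [lintegral_indicator_one (MeasurableSet.univ_pi fun j : s => hJ j), Measure.pi_pi,
      Finset.prod_coe_sort s fun j => unitLaw (J j), ENNReal.toReal_prod]
    refine Finset.prod_subset (Finset.subset_univ s) fun j _ hj => ?_
    rw [hu j hj]; simp
  · simp [hT]

end Marginals

theorem card_fin_interval {n lo hi : ℕ} (h : hi ≤ n) :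
    Fintype.card {a : Fin n // lo ≤ (a : ℕ) ∧ (a : ℕ) < hi} = hi - lo := by
  rw [Fintype.card_subtype, ← Nat.card_Ico lo hi]
  refine Finset.card_bij (fun a _ => (a : ℕ)) (fun a ha => ?_) (fun a _ b _ hab => Fin.ext hab)
    fun b hb => ?_
  · simpa using ha
  · rw [Finset.mem_Ico] at hb
    exact ⟨⟨b, by omega⟩, by simpa using hb, rfl⟩

theorem card_fiber_eq {n lo hi : ℕ} {ι : Type*} [DecidableEq ι] {f : Fin n → ι} {v : ι}
    (h : hi ≤ n) (hf : ∀ a, f a = v ↔ lo ≤ (a : ℕ) ∧ (a : ℕ) < hi) :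
    Fintype.card {a // f a = v} = hi - lo := by
  rw [← card_fin_interval (lo := lo) h]
  exact Fintype.card_congr (Equiv.subtypeEquivRight hf)

theorem prod_comp_fiber {n : ℕ} {ι : Type*} [Fintype ι] [DecidableEq ι] (f : Fin n → ι)
    (g : ι → ℝ) : ∏ j, g (f j) = ∏ v, g v ^ Fintype.card {a // f a = v} := by
  rw [← Finset.prod_fiberwise' Finset.univ f g]
  simp [Fintype.card_subtype]

/-- The Beta integral: integration by parts trades one unit of `q` for one of `p`, which is why the
induction on `q` keeps `p` general. -/
theorem integral_pow_mul_pow (p q : ℕ) (α β : ℝ) :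
    ∫ x in α..β, (x - α) ^ p * (β - x) ^ q =
      p.factorial * q.factorial / (p + q + 1).factorial * (β - α) ^ (p + q + 1) := by
  induction q generalizing p with
  | zero =>
    have : ∫ x in α..β, (x - α) ^ p = (β - α) ^ (p + 1) / (p + 1) := by
      rw [intervalIntegral.integral_comp_sub_right (fun x => x ^ p), integral_pow]
      simp
    simp only [pow_zero, mul_one, this, Nat.factorial_zero, Nat.cast_one, add_zero,
      Nat.factorial_succ]
    push_cast
    field_simp
  | succ q ih =>
    have hu : ∀ x ∈ Set.uIcc α β, HasDerivAt (fun x => (β - x) ^ (q + 1))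
        (-((q + 1) * (β - x) ^ q)) x := by
      intro x _
      have := ((hasDerivAt_id' x).const_sub β).fun_pow (q + 1)
      exact this.congr_deriv (by push_cast [Nat.add_sub_cancel]; ring)
    have hv : ∀ x ∈ Set.uIcc α β, HasDerivAt (fun x => (x - α) ^ (p + 1) / (p + 1))
        ((x - α) ^ p) x := by
      intro x _
      have := (((hasDerivAt_id' x).sub_const α).fun_pow (p + 1)).div_const ((p : ℝ) + 1)
      exact this.congr_deriv (by push_cast [Nat.add_sub_cancel]; field_simp)
    have h := intervalIntegral.integral_mul_deriv_eq_deriv_mul hu hv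
      (Continuous.intervalIntegrable (by fun_prop) _ _)
      (Continuous.intervalIntegrable (by fun_prop) _ _)
    have h2 : ∫ x in α..β, -((q + 1) * (β - x) ^ q) * ((x - α) ^ (p + 1) / (p + 1)) =
        -((q + 1) / (p + 1) * ∫ x in α..β, (x - α) ^ (p + 1) * (β - x) ^ q) := by
      rw [← intervalIntegral.integral_const_mul, ← intervalIntegral.integral_neg]
      congr 1; funext x; ring
    simp only [mul_comm ((_ - α) ^ p)]
    rw [h, h2, ih (p + 1), show p + (q + 1) + 1 = p + 1 + q + 1 by ring, Nat.factorial_succ p,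
      Nat.factorial_succ q]
    push_cast
    have : (((p + 1 + q + 1).factorial : ℕ) : ℝ) ≠ 0 := by positivity
    simp
    field_simp

section SortedBlocks

variable {n : ℕ} {ι : Type*} [LinearOrder ι] {f : Fin n → ι} {y : Fin n → ℝ}

theorem BlockSorted.sorted_eq (hf : Monotone f) (hy : Function.Injective y) (h : BlockSorted f y)
    (p : Fin n) : ∃ q, f q = f p ∧ sorted y p = y q :=
  ⟨Tuple.sort y p, congrFun (h.comp_sort hf hy) p, rfl⟩

theorem BlockSorted.sorted_eq_self (hf : Monotone f) (hy : Function.Injective y)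
    (h : BlockSorted f y) {p : Fin n} (hp : ∀ a, f a = f p → a = p) : sorted y p = y p := by
  obtain ⟨q, hq, hqy⟩ := h.sorted_eq hf hy p
  rw [hqy, hp q hq]

/-- Sorting only permutes within blocks, so the sorted position of `y j` lies in the block of `p`,
hence not before its first index. -/
theorem BlockSorted.sorted_le (hf : Monotone f) (hy : Function.Injective y) (h : BlockSorted f y)
    {p : Fin n} (hp : ∀ a, f a = f p → p ≤ a) {j : Fin n} (hj : f j = f p) :
    sorted y p ≤ y j := by
  have h1 := congrFun (h.comp_sort hf hy) ((Tuple.sort y).symm j)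
  simp only [Function.comp_apply, Equiv.apply_symm_apply] at h1
  have h2 := monotone_sorted y (hp _ (h1.symm.trans hj))
  simpa [sorted] using h2

end SortedBlocks

/-! ### The end terms -/

theorem unitLaw_real_Ioo {a b : ℝ} (ha : 0 ≤ a) (hab : a ≤ b) (hb : b ≤ 1) :
    unitLaw.real (Set.Ioo a b) = b - a := by
  rw [measureReal_restrict_apply measurableSet_Ioo, Set.inter_eq_left.2
    (Set.Ioo_subset_Icc_self.trans (Set.Icc_subset_Icc ha hb)), Real.volume_real_Ioo_of_le hab]

theorem unitLaw_real_Ioi {a : ℝ} (ha : 0 ≤ a) (ha1 : a ≤ 1) :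
    unitLaw.real (Set.Ioi a) = 1 - a := by
  have : Set.Ioi a ∩ Set.Icc 0 1 = Set.Ioc a 1 := by
    ext x; simp only [Set.mem_inter_iff, Set.mem_Ioi, Set.mem_Icc, Set.mem_Ioc]
    constructor
    · rintro ⟨h1, h2, h3⟩; exact ⟨h1, h3⟩
    · rintro ⟨h1, h3⟩; exact ⟨h1, by linarith, h3⟩
  rw [measureReal_restrict_apply measurableSet_Ioi, this, Real.volume_real_Ioc_of_le ha1]

/-- Blocks of sizes `1, m, 1, h`. -/
def endBlocks (m h : ℕ) (j : Fin (m + h + 2)) : Fin 4 :=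
  if (j : ℕ) = 0 then 0 else if (j : ℕ) ≤ m then 1 else if (j : ℕ) = m + 1 then 2 else 3

theorem monotone_endBlocks (m h : ℕ) : Monotone (endBlocks m h) := by
  intro i j hij
  have : (i : ℕ) ≤ j := hij
  unfold endBlocks
  split_ifs <;> first | decide | omega

theorem card_endBlocks (m h : ℕ) (v : Fin 4) :
    Fintype.card {a // endBlocks m h a = v} = ![1, m, 1, h] v := by
  have h0 : ∀ a, endBlocks m h a = 0 ↔ 0 ≤ (a : ℕ) ∧ (a : ℕ) < 1 := by
    intro a; unfold endBlocks
    split_ifs <;> first | exact iff_of_true rfl (by omega) | exact iff_of_false (by decide) (by omega)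
  have h1 : ∀ a, endBlocks m h a = 1 ↔ 1 ≤ (a : ℕ) ∧ (a : ℕ) < m + 1 := by
    intro a; unfold endBlocks
    split_ifs <;> first | exact iff_of_true rfl (by omega) | exact iff_of_false (by decide) (by omega)
  have h2 : ∀ a, endBlocks m h a = 2 ↔ m + 1 ≤ (a : ℕ) ∧ (a : ℕ) < m + 2 := by
    intro a; unfold endBlocks
    split_ifs <;> first | exact iff_of_true rfl (by omega) | exact iff_of_false (by decide) (by omega)
  have h3 : ∀ a, endBlocks m h a = 3 ↔ m + 2 ≤ (a : ℕ) ∧ (a : ℕ) < m + h + 2 := by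
    intro a; unfold endBlocks
    split_ifs <;> first | exact iff_of_true rfl (by omega) | exact iff_of_false (by decide) (by omega)
  fin_cases v
  · exact (card_fiber_eq (by omega) h0)
  · exact (card_fiber_eq (by omega) h1).trans (by simp)
  · exact (card_fiber_eq (by omega) h2).trans (by simp)
  · exact (card_fiber_eq (by omega) h3).trans (by simp)

/-- Fixing the two singleton blocks decouples the remaining coordinates: each is constrained
separately, to lie between the fixed values or beyond the larger one. -/
theorem blockSorted_endBlocks_iff (m h : ℕ) (y : Fin (m + h + 2) → ℝ) {b d : ℝ}
    (hb : y ⟨0, by omega⟩ = b) (hd : y ⟨m + 1, by omega⟩ = d) :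
    BlockSorted (endBlocks m h) y ↔ b < d ∧
      ∀ j, j ≠ ⟨0, by omega⟩ → j ≠ ⟨m + 1, by omega⟩ →
        y j ∈ (![Set.univ, Set.Ioo b d, Set.univ, Set.Ioi d] : Fin 4 → Set ℝ)
          (endBlocks m h j) := by
  have e0 : endBlocks m h ⟨0, by omega⟩ = 0 := by simp [endBlocks]
  have e2 : endBlocks m h ⟨m + 1, by omega⟩ = 2 := by simp [endBlocks]
  constructor
  · intro H
    refine ⟨hb ▸ hd ▸ H _ _ (by rw [e0, e2]; decide), fun j h1 h2 => ?_⟩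
    have hj0 := H ⟨0, by omega⟩ j
    have hj2 := H j ⟨m + 1, by omega⟩
    have hj2' := H ⟨m + 1, by omega⟩ j
    rw [e0, hb] at hj0
    rw [e2, hd] at hj2 hj2'
    generalize endBlocks m h j = v at *
    fin_cases v <;> simp_all
  · rintro ⟨hbd, H⟩
    have key : ∀ j, (endBlocks m h j = 0 → y j = b) ∧ (endBlocks m h j = 1 → b < y j ∧ y j < d) ∧
        (endBlocks m h j = 2 → y j = d) ∧ (endBlocks m h j = 3 → d < y j) := by
      intro j
      by_cases h1 : j = (⟨0, by omega⟩ : Fin (m + h + 2))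
      · rw [h1, e0, hb]; simp
      by_cases h2 : j = (⟨m + 1, by omega⟩ : Fin (m + h + 2))
      · rw [h2, e2, hd]; simp
      have := H j h1 h2
      have n0 : endBlocks m h j ≠ 0 := by
        have h1' : (j : ℕ) ≠ 0 := fun h => h1 (Fin.ext h)
        unfold endBlocks; split_ifs <;> first | decide | omega
      have n2 : endBlocks m h j ≠ 2 := by
        have h2' : (j : ℕ) ≠ m + 1 := fun h => h2 (Fin.ext h)
        unfold endBlocks; split_ifs <;> decide
      generalize endBlocks m h j = v at *
      fin_cases v <;> simp_all
    intro j k hjk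
    have hj := key j
    have hk := key k
    generalize endBlocks m h j = v at *
    generalize endBlocks m h k = w at *
    fin_cases v <;> fin_cases w <;> simp at hjk hj hk <;> first | omega | linarith

theorem integral_endBlocks (m h : ℕ) (s : ℝ) :
    (uniformLaw (m + h + 2)).real {y | BlockSorted (endBlocks m h) y ∧
        s ≤ y ⟨0, by omega⟩ + y ⟨m + 1, by omega⟩} =
      ∫ d, (∫ b, (if b < d ∧ s ≤ b + d then
        unitLaw.real (Set.Ioo b d) ^ m * unitLaw.real (Set.Ioi d) ^ h else 0) ∂unitLaw)
          ∂unitLaw := by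
  classical
  set p : Fin (m + h + 2) := ⟨0, by omega⟩ with hp
  set q : Fin (m + h + 2) := ⟨m + 1, by omega⟩ with hq
  have hpq : p ≠ q := by simp [hp, hq, Fin.ext_iff]
  set A := {y | BlockSorted (endBlocks m h) y ∧ s ≤ y p + y q} with hA
  have hAm : MeasurableSet A := (measurableSet_blockSorted _).inter
    (measurableSet_le measurable_const ((measurable_pi_apply p).add (measurable_pi_apply q)))
  set S : Finset (Fin (m + h + 2)) := Finset.univ \ {p, q} with hS
  have hpS : p ∉ S := by simp [hS]
  have hqS : q ∉ insert p S := by simp [hS, hpq.symm]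
  have huniv : (Finset.univ : Finset (Fin (m + h + 2))) = insert q (insert p S) := by
    ext j; simp only [hS, Finset.mem_univ, Finset.mem_insert, Finset.mem_sdiff]
    by_cases h1 : j = p <;> by_cases h2 : j = q <;> simp [h1, h2]
  have hm : Measurable (A.indicator (1 : (Fin (m + h + 2) → ℝ) → ENNReal)) :=
    measurable_one.indicator hAm
  have h1 : ∀ x, A.indicator (1 : (Fin (m + h + 2) → ℝ) → ENNReal) x ≤ 1 := fun x =>
    Set.indicator_le_self' (by simp) x
  have h2 : uniformLaw (m + h + 2) A =
      (∫⋯∫⁻_insert q (insert p S), A.indicator 1 ∂fun _ => unitLaw) 0 := by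
    rw [← huniv, ← lintegral_eq_lmarginal_univ, ← lintegral_indicator_one hAm]; rfl
  rw [measureReal_def, h2, toReal_lmarginal_insert hm h1 hqS]
  refine integral_congr_ae (Eventually.of_forall fun d => ?_)
  simp only
  rw [toReal_lmarginal_insert hm h1 hpS]
  refine integral_congr_ae (Eventually.of_forall fun b => ?_)
  simp only
  set J : Fin 4 → Set ℝ := ![Set.univ, Set.Ioo b d, Set.univ, Set.Ioi d] with hJ
  rw [toReal_lmarginal_box (T := b < d ∧ s ≤ b + d) (J := fun j => J (endBlocks m h j))]
  · congr 1
    rw [prod_comp_fiber _ fun v => unitLaw.real (J v)]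
    simp only [card_endBlocks, Fin.prod_univ_four]
    simp [J]
  · intro j
    have : ∀ v, MeasurableSet (J v) := by
      intro v; fin_cases v
      · exact MeasurableSet.univ
      · exact measurableSet_Ioo
      · exact MeasurableSet.univ
      · exact measurableSet_Ioi
    exact this _
  · intro j hj
    have : j = p ∨ j = q := by simpa [hS, or_iff_not_imp_left] using hj
    rcases this with rfl | rfl
    · simp [endBlocks, hp, hJ]
    · simp [endBlocks, hq, hJ]
  · intro y hy
    have hyp : y p = b := by rw [hy p hpS]; simp
    have hyq : y q = d := by
      rw [hy q (fun h => hqS (Finset.mem_insert_of_mem h))]; simp [hpq.symm]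
    rw [hA, Set.mem_ofPred_eq, blockSorted_endBlocks_iff m h y hyp hyq, hyp, hyq]
    have : (∀ j ∈ S, y j ∈ J (endBlocks m h j)) ↔
        ∀ j, j ≠ p → j ≠ q → y j ∈ J (endBlocks m h j) := by
      simp [hS]
    rw [this]
    tauto

/-- For fixed `d`, `b` runs over [s - d, d), which is within [0, 1] because s ≥ 1, and has length
2(d - s/2). This yields the power of 2 and leaves a Beta integral over (s/2, 1]. -/
theorem integral_end_eval (m h : ℕ) {s : ℝ} (hs1 : 1 ≤ s) (hs2 : s ≤ 2) :
    ∫ d, (∫ b, (if b < d ∧ s ≤ b + d then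
        unitLaw.real (Set.Ioo b d) ^ m * unitLaw.real (Set.Ioi d) ^ h else 0) ∂unitLaw)
          ∂unitLaw =
      m.factorial * h.factorial / (m + h + 2).factorial *
        (2 ^ (m + 1) * (1 - s / 2) ^ (m + h + 2)) := by
  have inner : ∀ d ∈ Set.Icc (0 : ℝ) 1, (∫ b, (if b < d ∧ s ≤ b + d then
        unitLaw.real (Set.Ioo b d) ^ m * unitLaw.real (Set.Ioi d) ^ h else 0) ∂unitLaw) =
      (Set.Ioc (s / 2) 1).indicator (fun d =>
        (d - s / 2) ^ (m + 1) * (1 - d) ^ h * (2 ^ (m + 1) / (m + 1))) d := by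
    intro d hd
    have h1 : ∀ b ∈ Set.Icc (0 : ℝ) 1, (if b < d ∧ s ≤ b + d then
        unitLaw.real (Set.Ioo b d) ^ m * unitLaw.real (Set.Ioi d) ^ h else 0) =
        (Set.Ico (s - d) d).indicator (fun b => (d - b) ^ m * (1 - d) ^ h) b := by
      intro b hb
      by_cases hbd : b < d ∧ s ≤ b + d
      · rw [if_pos hbd, Set.indicator_of_mem (show b ∈ Set.Ico (s - d) d from ⟨by linarith [hbd.2], hbd.1⟩),
          unitLaw_real_Ioo hb.1 hbd.1.le hd.2, unitLaw_real_Ioi hd.1 hd.2]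
      · rw [if_neg hbd, Set.indicator_of_notMem]
        rintro ⟨h2, h3⟩
        exact hbd ⟨h3, by linarith⟩
    have hsub : Set.Ico (s - d) d ⊆ Set.Icc 0 1 := fun b hb =>
      ⟨by linarith [hb.1, hd.2], by linarith [hb.2, hd.2]⟩
    rw [setIntegral_congr_fun measurableSet_Icc h1, setIntegral_indicator measurableSet_Ico,
      Set.inter_eq_right.2 hsub]
    by_cases hsd : s / 2 < d
    · rw [Set.indicator_of_mem (show d ∈ Set.Ioc (s / 2) 1 from ⟨hsd, hd.2⟩), integral_Ico_eq_integral_Ioc,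
        ← intervalIntegral.integral_of_le (by linarith), intervalIntegral.integral_mul_const,
        intervalIntegral.integral_comp_sub_left (fun x => x ^ m), integral_pow]
      have : d - (s - d) = 2 * (d - s / 2) := by ring
      rw [this, mul_pow]
      simp
      ring
    · rw [Set.indicator_of_notMem (fun h => hsd h.1), Set.Ico_eq_empty (by linarith)]
      simp
  have hsub : Set.Ioc (s / 2) 1 ⊆ Set.Icc 0 1 := fun d hd => ⟨by linarith [hd.1], hd.2⟩
  rw [setIntegral_congr_fun measurableSet_Icc inner, setIntegral_indicator measurableSet_Ioc,
    Set.inter_eq_right.2 hsub,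
    ← intervalIntegral.integral_of_le (by linarith), intervalIntegral.integral_mul_const,
    integral_pow_mul_pow, show m + 1 + h + 1 = m + h + 2 by ring, Nat.factorial_succ m]
  have : (((m + h + 2).factorial : ℕ) : ℝ) ≠ 0 := by positivity
  push_cast
  field_simp

/-- The probability that the least value and the one of rank `m + 2` have sum at least `s`. -/
theorem uniformLaw_sorted_end (m h : ℕ) {s : ℝ} (hs1 : 1 ≤ s) (hs2 : s ≤ 2) :
    (uniformLaw (m + h + 2)).real {x | s ≤ sorted x ⟨0, by omega⟩ + sorted x ⟨m + 1, by omega⟩} =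
      2 ^ (m + 1) * (1 - s / 2) ^ (m + h + 2) := by
  set p : Fin (m + h + 2) := ⟨0, by omega⟩ with hp
  set q : Fin (m + h + 2) := ⟨m + 1, by omega⟩ with hq
  have hm : MeasurableSet {z : Fin (m + h + 2) → ℝ | s ≤ z p + z q} :=
    measurableSet_le measurable_const ((measurable_pi_apply p).add (measurable_pi_apply q))
  have h1 := prod_factorial_mul_uniformLaw (monotone_endBlocks m h) hm hm (by
    intro y hy hB
    have h1 : sorted y p = y p := by
      refine hB.sorted_eq_self (monotone_endBlocks m h) hy fun a ha => ?_
      rw [Fin.ext_iff]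
      revert ha
      unfold endBlocks
      split_ifs <;> simp_all
    have h2 : sorted y q = y q := by
      refine hB.sorted_eq_self (monotone_endBlocks m h) hy fun a ha => ?_
      rw [Fin.ext_iff]
      revert ha
      unfold endBlocks
      split_ifs <;> simp_all
    simp only [Set.mem_ofPred_eq, h1, h2])
  have h2 := congrArg ENNReal.toReal h1
  simp only [ENNReal.toReal_mul, ENNReal.toReal_natCast] at h2
  have h3 := (integral_endBlocks m h s).trans (integral_end_eval m h hs1 hs2)
  simp only [card_endBlocks, Fin.prod_univ_four] at h2
  simp only [measureReal_def] at h3 ⊢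
  have h4 : (((m + h + 2).factorial : ℕ) : ℝ) ≠ 0 := by positivity
  have h5 : ((m.factorial : ℕ) : ℝ) ≠ 0 := by positivity
  have h6 : ((h.factorial : ℕ) : ℝ) ≠ 0 := by positivity
  simp only [Set.mem_ofPred_eq] at h2
  rw [h3] at h2
  simp at h2
  field_simp at h2
  rw [show 1 - s / 2 = (2 - s) / 2 by ring]
  exact h2

/-! ### The middle terms -/

theorem unitLaw_real_Iio {a : ℝ} (ha : 0 ≤ a) (ha1 : a ≤ 1) : unitLaw.real (Set.Iio a) = a := by
  have : Set.Iio a ∩ Set.Icc 0 1 = Set.Ico 0 a := by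
    ext x; simp only [Set.mem_inter_iff, Set.mem_Iio, Set.mem_Icc, Set.mem_Ico]
    constructor
    · rintro ⟨h1, h2, h3⟩; exact ⟨h2, h1⟩
    · rintro ⟨h1, h3⟩; exact ⟨h3, h1, by linarith⟩
  rw [measureReal_restrict_apply measurableSet_Iio, this, Real.volume_real_Ico_of_le ha, sub_zero]

theorem unitLaw_real_Ioi_inter_Ici {a b : ℝ} (ha : 0 ≤ a) :
    unitLaw.real (Set.Ioi a ∩ Set.Ici b) = max (1 - max a b) 0 := by
  have : (Set.Ioi a ∩ Set.Ici b : Set ℝ) =ᵐ[unitLaw] (Set.Ioi (max a b) : Set ℝ) := by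
    rw [← Set.Ioi_inter_Ioi]
    exact (ae_eq_refl _).inter (Ioi_ae_eq_Ici).symm
  rw [measureReal_congr this]
  rcases le_total (max a b) 1 with h | h
  · rw [unitLaw_real_Ioi (ha.trans (le_max_left _ _)) h,
      max_eq_left (show 0 ≤ 1 - max a b by linarith)]
  · have h2 : Set.Ioi (max a b) ∩ Set.Icc 0 1 = ∅ := by
      ext x; simp only [Set.mem_inter_iff, Set.mem_Ioi, Set.mem_Icc, Set.mem_empty_iff_false,
        iff_false]
      rintro ⟨h1, -, h3⟩; linarith
    rw [measureReal_restrict_apply measurableSet_Ioi, h2,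
      max_eq_right (show 1 - max a b ≤ 0 by linarith)]
    simp

/-- Blocks of sizes `l, 1, 1, m, 1, h`. -/
def middleBlocks (l m h : ℕ) (j : Fin (l + m + h + 3)) : Fin 6 :=
  if (j : ℕ) < l then 0 else if (j : ℕ) = l then 1 else if (j : ℕ) = l + 1 then 2 else
    if (j : ℕ) < l + m + 2 then 3 else if (j : ℕ) = l + m + 2 then 4 else 5

theorem monotone_middleBlocks (l m h : ℕ) : Monotone (middleBlocks l m h) := by
  intro i j hij
  have : (i : ℕ) ≤ j := hij
  unfold middleBlocks
  split_ifs <;> first | decide | omega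

theorem middleBlocks_eq_iff (l m h : ℕ) (a : Fin (l + m + h + 3)) :
    (middleBlocks l m h a = 0 ↔ 0 ≤ (a : ℕ) ∧ (a : ℕ) < l) ∧
    (middleBlocks l m h a = 1 ↔ l ≤ (a : ℕ) ∧ (a : ℕ) < l + 1) ∧
    (middleBlocks l m h a = 2 ↔ l + 1 ≤ (a : ℕ) ∧ (a : ℕ) < l + 2) ∧
    (middleBlocks l m h a = 3 ↔ l + 2 ≤ (a : ℕ) ∧ (a : ℕ) < l + m + 2) ∧
    (middleBlocks l m h a = 4 ↔ l + m + 2 ≤ (a : ℕ) ∧ (a : ℕ) < l + m + 3) ∧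
    (middleBlocks l m h a = 5 ↔ l + m + 3 ≤ (a : ℕ) ∧ (a : ℕ) < l + m + h + 3) := by
  have ha := a.2
  unfold middleBlocks
  refine ⟨?_, ?_, ?_, ?_, ?_, ?_⟩ <;> split_ifs <;>
    first | exact iff_of_true rfl (by omega) | exact iff_of_false (by decide) (by omega)

theorem card_middleBlocks (l m h : ℕ) (v : Fin 6) :
    Fintype.card {a // middleBlocks l m h a = v} = ![l, 1, 1, m, 1, h] v := by
  have H := middleBlocks_eq_iff l m h
  fin_cases v
  · exact (card_fiber_eq (by omega) fun a => (H a).1).trans (by simp)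
  · exact (card_fiber_eq (by omega) fun a => (H a).2.1).trans (by simp)
  · exact (card_fiber_eq (by omega) fun a => (H a).2.2.1).trans (by simp)
  · exact (card_fiber_eq (by omega) fun a => (H a).2.2.2.1).trans (by simp)
  · exact (card_fiber_eq (by omega) fun a => (H a).2.2.2.2.1).trans (by simp)
  · exact (card_fiber_eq (by omega) fun a => (H a).2.2.2.2.2).trans (by simp)

/-- The constraints on the blocks when the distinguished values are `a < b < c`, and the values
of the last block are at least `t`. -/
def middleConstraint (a b c t : ℝ) : Fin 6 → Set ℝ :=
  ![Set.Iio a, Set.univ, Set.univ, Set.Ioo b c, Set.univ, Set.Ioi c ∩ Set.Ici t]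

theorem measurableSet_middleConstraint (a b c t : ℝ) (v : Fin 6) :
    MeasurableSet (middleConstraint a b c t v) := by
  fin_cases v
  · exact measurableSet_Iio
  · exact MeasurableSet.univ
  · exact MeasurableSet.univ
  · exact measurableSet_Ioo
  · exact MeasurableSet.univ
  · exact measurableSet_Ioi.inter measurableSet_Ici

/-- Four order statistics enter a middle term, but three fixed values suffice: a lower bound on the
fourth, the least of the last block, is the same bound on each member of that block. The event
therefore stays a box. -/
theorem blockSorted_middleBlocks_iff (l m h : ℕ) (y : Fin (l + m + h + 3) → ℝ) {a b c t : ℝ}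
    {p q r : Fin (l + m + h + 3)} (hp : (p : ℕ) = l) (hq : (q : ℕ) = l + 1)
    (hr : (r : ℕ) = l + m + 2) (ha : y p = a) (hb : y q = b) (hc : y r = c) :
    (BlockSorted (middleBlocks l m h) y ∧ ∀ j, middleBlocks l m h j = 5 → t ≤ y j) ↔
      (a < b ∧ b < c) ∧ ∀ j, j ≠ p → j ≠ q → j ≠ r →
        y j ∈ middleConstraint a b c t (middleBlocks l m h j) := by
  have e1 : middleBlocks l m h p = 1 := (middleBlocks_eq_iff l m h p).2.1.2 (by omega)
  have e2 : middleBlocks l m h q = 2 := (middleBlocks_eq_iff l m h q).2.2.1.2 (by omega)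
  have e4 : middleBlocks l m h r = 4 := (middleBlocks_eq_iff l m h r).2.2.2.2.1.2 (by omega)
  constructor
  · rintro ⟨H, Ht⟩
    refine ⟨⟨ha ▸ hb ▸ H _ _ (by rw [e1, e2]; decide), hb ▸ hc ▸ H _ _ (by rw [e2, e4]; decide)⟩,
      fun j h1 h2 h3 => ?_⟩
    have hj1 := H j p
    have hj2 := H q j
    have hj4 := H j r
    have hj4' := H r j
    have hj5 := Ht j
    rw [e1, ha] at hj1
    rw [e2, hb] at hj2
    rw [e4, hc] at hj4 hj4'
    unfold middleConstraint
    generalize middleBlocks l m h j = v at *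
    fin_cases v <;> simp_all
  · rintro ⟨⟨hab, hbc⟩, H⟩
    have key : ∀ j, (middleBlocks l m h j = 0 → y j < a) ∧ (middleBlocks l m h j = 1 → y j = a) ∧
        (middleBlocks l m h j = 2 → y j = b) ∧ (middleBlocks l m h j = 3 → b < y j ∧ y j < c) ∧
        (middleBlocks l m h j = 4 → y j = c) ∧
        (middleBlocks l m h j = 5 → c < y j ∧ t ≤ y j) := by
      intro j
      by_cases h1 : j = p
      · rw [h1, e1, ha]; simp
      by_cases h2 : j = q
      · rw [h2, e2, hb]; simp
      by_cases h3 : j = r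
      · rw [h3, e4, hc]; simp
      have := H j h1 h2 h3
      have n1 : middleBlocks l m h j ≠ 1 := fun e => h1 (Fin.ext (by
        have := (middleBlocks_eq_iff l m h j).2.1.1 e; omega))
      have n2 : middleBlocks l m h j ≠ 2 := fun e => h2 (Fin.ext (by
        have := (middleBlocks_eq_iff l m h j).2.2.1.1 e; omega))
      have n4 : middleBlocks l m h j ≠ 4 := fun e => h3 (Fin.ext (by
        have := (middleBlocks_eq_iff l m h j).2.2.2.2.1.1 e; omega))
      unfold middleConstraint at this
      generalize middleBlocks l m h j = v at *
      fin_cases v <;> simp_all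
    refine ⟨?_, fun j hj => ((key j).2.2.2.2.2 hj).2⟩
    intro j k hjk
    have hj := key j
    have hk := key k
    generalize middleBlocks l m h j = v at *
    generalize middleBlocks l m h k = w at *
    fin_cases v <;> fin_cases w <;> simp at hjk hj hk <;> first | omega | linarith

theorem measurableSet_lastBlock (l m h : ℕ) (s : ℝ) (q : Fin (l + m + h + 3)) :
    MeasurableSet {y : Fin (l + m + h + 3) → ℝ |
      ∀ j, middleBlocks l m h j = 5 → s ≤ y q + y j} := by
  have : {y : Fin (l + m + h + 3) → ℝ | ∀ j, middleBlocks l m h j = 5 → s ≤ y q + y j} =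
      ⋂ (j) (_ : middleBlocks l m h j = 5), {y | s ≤ y q + y j} := by ext; simp
  rw [this]
  exact MeasurableSet.iInter fun j => MeasurableSet.iInter fun _ =>
    measurableSet_le measurable_const ((measurable_pi_apply q).add (measurable_pi_apply j))

theorem integral_middleBlocks (l m h : ℕ) (s u : ℝ) {p q r : Fin (l + m + h + 3)}
    (hp : (p : ℕ) = l) (hq : (q : ℕ) = l + 1) (hr : (r : ℕ) = l + m + 2) :
    (uniformLaw (l + m + h + 3)).real {y | BlockSorted (middleBlocks l m h) y ∧
        (y p + y r ≤ u ∧ ∀ j, middleBlocks l m h j = 5 → s ≤ y q + y j)} =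
      ∫ a, (∫ b, (∫ c, (if (a < b ∧ b < c) ∧ a + c ≤ u then
        unitLaw.real (Set.Iio a) ^ l * unitLaw.real (Set.Ioo b c) ^ m *
          unitLaw.real (Set.Ioi c ∩ Set.Ici (s - b)) ^ h else 0) ∂unitLaw) ∂unitLaw) ∂unitLaw := by
  classical
  have hpq : p ≠ q := fun e => by rw [e] at hp; omega
  have hpr : p ≠ r := fun e => by rw [e] at hp; omega
  have hqr : q ≠ r := fun e => by rw [e] at hq; omega
  have e1 : middleBlocks l m h p = 1 := (middleBlocks_eq_iff l m h p).2.1.2 (by omega)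
  have e2 : middleBlocks l m h q = 2 := (middleBlocks_eq_iff l m h q).2.2.1.2 (by omega)
  have e4 : middleBlocks l m h r = 4 := (middleBlocks_eq_iff l m h r).2.2.2.2.1.2 (by omega)
  set A := {y | BlockSorted (middleBlocks l m h) y ∧
        (y p + y r ≤ u ∧ ∀ j, middleBlocks l m h j = 5 → s ≤ y q + y j)} with hA
  have hAm : MeasurableSet A :=
    (measurableSet_blockSorted _).inter ((measurableSet_le
      ((measurable_pi_apply p).add (measurable_pi_apply r)) measurable_const).inter
        (measurableSet_lastBlock l m h s q))
  set S : Finset (Fin (l + m + h + 3)) := Finset.univ \ {p, q, r} with hS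
  have hrS : r ∉ S := by simp [hS]
  have hqS : q ∉ insert r S := by simp [hS, hqr]
  have hpS : p ∉ insert q (insert r S) := by simp [hS, hpq, hpr]
  have hmem : ∀ j, j ∉ S ↔ j = p ∨ j = q ∨ j = r := by intro j; simp [hS]; tauto
  have huniv : (Finset.univ : Finset (Fin (l + m + h + 3))) =
      insert p (insert q (insert r S)) := by
    ext j
    simp only [Finset.mem_univ, Finset.mem_insert, true_iff]
    by_cases h1 : j ∈ S
    · simp [h1]
    · rcases (hmem j).1 h1 with h | h | h <;> simp [h]
  have hm : Measurable (A.indicator (1 : (Fin (l + m + h + 3) → ℝ) → ENNReal)) :=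
    measurable_one.indicator hAm
  have h1 : ∀ x, A.indicator (1 : (Fin (l + m + h + 3) → ℝ) → ENNReal) x ≤ 1 := fun x =>
    Set.indicator_le_self' (by simp) x
  have h2 : uniformLaw (l + m + h + 3) A =
      (∫⋯∫⁻_insert p (insert q (insert r S)), A.indicator 1 ∂fun _ => unitLaw) 0 := by
    rw [← huniv, ← lintegral_eq_lmarginal_univ, ← lintegral_indicator_one hAm]; rfl
  rw [measureReal_def, h2, toReal_lmarginal_insert hm h1 hpS]
  refine integral_congr_ae (Eventually.of_forall fun a => ?_)
  simp only
  rw [toReal_lmarginal_insert hm h1 hqS]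
  refine integral_congr_ae (Eventually.of_forall fun b => ?_)
  simp only
  rw [toReal_lmarginal_insert hm h1 hrS]
  refine integral_congr_ae (Eventually.of_forall fun c => ?_)
  simp only
  rw [toReal_lmarginal_box (T := (a < b ∧ b < c) ∧ a + c ≤ u)
    (J := fun j => middleConstraint a b c (s - b) (middleBlocks l m h j))]
  · congr 1
    rw [prod_comp_fiber _ fun v => unitLaw.real (middleConstraint a b c (s - b) v)]
    simp only [card_middleBlocks, Fin.prod_univ_six]
    simp [middleConstraint]
  · exact fun j => measurableSet_middleConstraint _ _ _ _ _
  · intro j hj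
    rcases (hmem j).1 hj with rfl | rfl | rfl
    · simp [e1, middleConstraint]
    · simp [e2, middleConstraint]
    · simp [e4, middleConstraint]
  · intro y hy
    have hyp : y p = a := by rw [hy p ((hmem p).2 (by simp))]; simp [hpq, hpr]
    have hyq : y q = b := by rw [hy q ((hmem q).2 (by simp))]; simp [hqr]
    have hyr : y r = c := by rw [hy r ((hmem r).2 (by simp))]; simp
    have h5 := blockSorted_middleBlocks_iff l m h y (t := s - b) hp hq hr hyp hyq hyr
    have h6 : (∀ j ∈ S, y j ∈ middleConstraint a b c (s - b) (middleBlocks l m h j)) ↔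
        ∀ j, j ≠ p → j ≠ q → j ≠ r →
          y j ∈ middleConstraint a b c (s - b) (middleBlocks l m h j) := by
      simp [hS]
    rw [hA, Set.mem_ofPred_eq, h6, hyp, hyr, hyq]
    simp only [← sub_le_iff_le_add'] at h5 ⊢
    tauto

/-- Only the limits of integration have to be found. The assumption s ≥ 1 keeps the upper limit 2 -
s - a within [0, 1]. -/
theorem integral_middle_eval (l m : ℕ) {h : ℕ} (hh : h ≠ 0) {s : ℝ} (hs1 : 1 ≤ s) :
    ∫ a, (∫ b, (∫ c, (if (a < b ∧ b < c) ∧ a + c ≤ 2 - s then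
        unitLaw.real (Set.Iio a) ^ l * unitLaw.real (Set.Ioo b c) ^ m *
          unitLaw.real (Set.Ioi c ∩ Set.Ici (s - b)) ^ h else 0) ∂unitLaw) ∂unitLaw) ∂unitLaw =
    ∫ a in Set.Icc (0 : ℝ) (min (1 - s / 2) (3 - 2 * s)),
      ∫ b in Set.Icc (max a (s - 1)) (2 - s - a),
        ∫ c in Set.Icc b (2 - s - a), a ^ l * (c - b) ^ m * (1 - max c (s - b)) ^ h := by
  have innerc : ∀ a ∈ Set.Icc (0 : ℝ) 1, ∀ b ∈ Set.Icc (0 : ℝ) 1,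
      ∫ c, (if (a < b ∧ b < c) ∧ a + c ≤ 2 - s then
        unitLaw.real (Set.Iio a) ^ l * unitLaw.real (Set.Ioo b c) ^ m *
          unitLaw.real (Set.Ioi c ∩ Set.Ici (s - b)) ^ h else 0) ∂unitLaw =
      (Set.Ioc (max a (s - 1)) (2 - s - a)).indicator (fun b =>
        ∫ c in Set.Icc b (2 - s - a), a ^ l * (c - b) ^ m * (1 - max c (s - b)) ^ h) b := by
    intro a ha b hb
    by_cases hB : b ∈ Set.Ioc (max a (s - 1)) (2 - s - a)
    · have hab : a < b := (le_max_left _ _).trans_lt hB.1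
      have hsb : s - 1 < b := (le_max_right _ _).trans_lt hB.1
      have hc : ∀ c ∈ Set.Icc (0 : ℝ) 1, (if (a < b ∧ b < c) ∧ a + c ≤ 2 - s then
          unitLaw.real (Set.Iio a) ^ l * unitLaw.real (Set.Ioo b c) ^ m *
            unitLaw.real (Set.Ioi c ∩ Set.Ici (s - b)) ^ h else 0) =
          (Set.Ioc b (2 - s - a)).indicator
            (fun c => a ^ l * (c - b) ^ m * (1 - max c (s - b)) ^ h) c := by
        intro c hc
        by_cases hcb : b < c ∧ a + c ≤ 2 - s
        · rw [if_pos ⟨⟨hab, hcb.1⟩, hcb.2⟩, Set.indicator_of_mem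
            (show c ∈ Set.Ioc b (2 - s - a) from ⟨hcb.1, by linarith [hcb.2]⟩),
            unitLaw_real_Iio ha.1 ha.2, unitLaw_real_Ioo hb.1 hcb.1.le hc.2,
            unitLaw_real_Ioi_inter_Ici hc.1, max_eq_left]
          rw [sub_nonneg]
          exact max_le hc.2 (by linarith)
        · rw [if_neg (fun h => hcb ⟨h.1.2, h.2⟩), Set.indicator_of_notMem]
          rintro ⟨h1, h2⟩
          exact hcb ⟨h1, by linarith⟩
      have hsub : Set.Ioc b (2 - s - a) ⊆ Set.Icc 0 1 := fun c hc =>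
        ⟨by linarith [hc.1, hb.1], by linarith [hc.2, ha.1]⟩
      rw [setIntegral_congr_fun measurableSet_Icc hc, setIntegral_indicator measurableSet_Ioc,
        Set.inter_eq_right.2 hsub, Set.indicator_of_mem hB, integral_Icc_eq_integral_Ioc]
    · rw [Set.indicator_of_notMem hB]
      refine integral_eq_zero_of_ae ?_
      filter_upwards [ae_restrict_mem measurableSet_Icc] with c hc
      split_ifs with hT
      -- The remaining values of `b` are at most s - 1. The last block would then have to lie beyond
      -- 1, and its factor vanishes; a nonempty block is needed here, since 0 ^ 0 = 1.
      · have hsb : b ≤ s - 1 := by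
          by_contra! h1
          exact hB ⟨max_lt hT.1.1 h1, by linarith [hT.1.2, hT.2]⟩
        rw [unitLaw_real_Ioi_inter_Ici hc.1, max_eq_right, zero_pow hh, mul_zero]
        · rfl
        · have := le_max_right c (s - b)
          linarith
      · rfl
  have innerb : ∀ a ∈ Set.Icc (0 : ℝ) 1,
      ∫ b, (∫ c, (if (a < b ∧ b < c) ∧ a + c ≤ 2 - s then
        unitLaw.real (Set.Iio a) ^ l * unitLaw.real (Set.Ioo b c) ^ m *
          unitLaw.real (Set.Ioi c ∩ Set.Ici (s - b)) ^ h else 0) ∂unitLaw) ∂unitLaw =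
      ∫ b in Set.Icc (max a (s - 1)) (2 - s - a),
        ∫ c in Set.Icc b (2 - s - a), a ^ l * (c - b) ^ m * (1 - max c (s - b)) ^ h := by
    intro a ha
    have hsub : Set.Ioc (max a (s - 1)) (2 - s - a) ⊆ Set.Icc 0 1 := fun b hb =>
      ⟨by linarith [hb.1, ha.1, le_max_left a (s - 1)], by linarith [hb.2, ha.1]⟩
    rw [setIntegral_congr_fun measurableSet_Icc (innerc a ha),
      setIntegral_indicator measurableSet_Ioc, Set.inter_eq_right.2 hsub,
      integral_Icc_eq_integral_Ioc]
  rw [setIntegral_congr_fun measurableSet_Icc innerb]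
  refine setIntegral_eq_of_subset_of_forall_sdiff_eq_zero measurableSet_Icc
    (Set.Icc_subset_Icc_right ((min_le_left _ _).trans (by linarith))) fun a ha => ?_
  -- The range max a (s - 1) ≤ b ≤ 2 - s - a is nonempty exactly when a ≤ 1 - s/2 and a ≤ 3 - 2s.
  have hlt : min (1 - s / 2) (3 - 2 * s) < a := by
    by_contra! h1
    exact ha.2 ⟨ha.1.1, h1⟩
  rw [Set.Icc_eq_empty, Measure.restrict_empty, integral_zero_measure]
  rw [not_le]
  rcases min_lt_iff.1 hlt with h1 | h1
  · exact lt_max_of_lt_left (by linarith)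
  · exact lt_max_of_lt_right (by linarith)

/-- The probability that two pairs of order statistics at distance `m + 2` satisfy the bounds. -/
theorem uniformLaw_sorted_middle (l m : ℕ) {h : ℕ} (hh : h ≠ 0) {s : ℝ} (hs1 : 1 ≤ s)
    {p q r t : Fin (l + m + h + 3)} (hp : (p : ℕ) = l) (hq : (q : ℕ) = l + 1)
    (hr : (r : ℕ) = l + m + 2) (ht : (t : ℕ) = l + m + 3) :
    (uniformLaw (l + m + h + 3)).real
        {x | sorted x p + sorted x r ≤ 2 - s ∧ s ≤ sorted x q + sorted x t} =
      (l + m + h + 3).factorial / (l.factorial * m.factorial * h.factorial) *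
      ∫ a in Set.Icc (0 : ℝ) (min (1 - s / 2) (3 - 2 * s)),
        ∫ b in Set.Icc (max a (s - 1)) (2 - s - a),
          ∫ c in Set.Icc b (2 - s - a), a ^ l * (c - b) ^ m * (1 - max c (s - b)) ^ h := by
  have H := middleBlocks_eq_iff l m h
  have hmono := monotone_middleBlocks l m h
  have e1 : middleBlocks l m h p = 1 := (H p).2.1.2 (by omega)
  have e2 : middleBlocks l m h q = 2 := (H q).2.2.1.2 (by omega)
  have e4 : middleBlocks l m h r = 4 := (H r).2.2.2.2.1.2 (by omega)
  have e5 : middleBlocks l m h t = 5 := (H t).2.2.2.2.2.2 (by omega)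
  have hP : MeasurableSet {z : Fin (l + m + h + 3) → ℝ | z p + z r ≤ 2 - s ∧ s ≤ z q + z t} :=
    (measurableSet_le ((measurable_pi_apply p).add (measurable_pi_apply r)) measurable_const).inter
      (measurableSet_le measurable_const ((measurable_pi_apply q).add (measurable_pi_apply t)))
  have hQ : MeasurableSet {y : Fin (l + m + h + 3) → ℝ | y p + y r ≤ 2 - s ∧
      ∀ j, middleBlocks l m h j = 5 → s ≤ y q + y j} :=
    (measurableSet_le ((measurable_pi_apply p).add (measurable_pi_apply r)) measurable_const).inter
      (measurableSet_lastBlock l m h s q)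
  have h1 := prod_factorial_mul_uniformLaw hmono hP hQ (by
    intro y hy hB
    have h1 : sorted y p = y p := hB.sorted_eq_self hmono hy fun a ha => Fin.ext (by
      have := (H a).2.1.1 (ha.trans e1); omega)
    have h2 : sorted y q = y q := hB.sorted_eq_self hmono hy fun a ha => Fin.ext (by
      have := (H a).2.2.1.1 (ha.trans e2); omega)
    have h3 : sorted y r = y r := hB.sorted_eq_self hmono hy fun a ha => Fin.ext (by
      have := (H a).2.2.2.2.1.1 (ha.trans e4); omega)
    simp only [Set.mem_ofPred_eq, h1, h2, h3]
    -- `t` is the first index of the last block, so `sorted y t` is the minimum of `y` over that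
    -- block.
    refine and_congr_right fun _ => ⟨fun h4 j hj => ?_, fun h4 => ?_⟩
    · have := hB.sorted_le hmono hy (p := t) (fun a ha => Fin.le_def.2 (by
        have := (H a).2.2.2.2.2.1 (ha.trans e5); omega)) (hj.trans e5.symm)
      linarith
    · obtain ⟨j, hj, hjy⟩ := hB.sorted_eq hmono hy t
      rw [hjy]
      exact h4 j (hj.trans e5))
  have h2 := congrArg ENNReal.toReal h1
  simp only [ENNReal.toReal_mul, ENNReal.toReal_natCast] at h2
  have h3 := (integral_middleBlocks l m h s (2 - s) hp hq hr).trans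
    (integral_middle_eval l m hh hs1)
  simp only [card_middleBlocks, Fin.prod_univ_six] at h2
  simp only [measureReal_def] at h3 ⊢
  simp only [Set.mem_ofPred_eq] at h2
  rw [h3] at h2
  have h5 : ((l.factorial : ℕ) : ℝ) ≠ 0 := by positivity
  have h6 : ((m.factorial : ℕ) : ℝ) ≠ 0 := by positivity
  have h7 : ((h.factorial : ℕ) : ℝ) ≠ 0 := by positivity
  rw [div_mul_eq_mul_div, eq_div_iff (by positivity), ← h2]
  simp
  ring

/-! ### Window events and the closed form of the bound -/

/-- The event that the window of `K` consecutive order statistics starting at rank `i` can attract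
enough users, up to `η`. -/
def windowEvent (C K i : ℕ) (η : ℝ) : Set (Fin C → ℝ) :=
  {x | (∀ p q : Fin C, (p : ℕ) + 1 = i → (q : ℕ) + 1 = K + i →
      2 * ((K : ℝ) / C - η) ≤ sorted x p + sorted x q) ∧
    ∀ p q : Fin C, (p : ℕ) + 2 = i → (q : ℕ) + 2 = K + i →
      sorted x p + sorted x q ≤ 2 * (1 - (K : ℝ) / C + η)}

/-- Ranks in `windowEvent` are given by equations in the zero-based indices. They have one solution
or none; none occurs at the two ends, where the vacuous condition plays the role of X_0 = -∞ and
X_{C+1} = +∞. -/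
theorem forall_fin_pair_iff {n i j k : ℕ} {φ : Fin n → Fin n → Prop} {p₀ q₀ : Fin n}
    (hp₀ : (p₀ : ℕ) + k = i) (hq₀ : (q₀ : ℕ) + k = j) :
    (∀ p q : Fin n, (p : ℕ) + k = i → (q : ℕ) + k = j → φ p q) ↔ φ p₀ q₀ := by
  refine ⟨fun h => h _ _ hp₀ hq₀, fun h p q hp hq => ?_⟩
  rwa [show p = p₀ from Fin.ext (by omega), show q = q₀ from Fin.ext (by omega)]

theorem measurableSet_windowEvent (C K i : ℕ) (η : ℝ) : MeasurableSet (windowEvent C K i η) := by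
  have hs : ∀ p : Fin C, Measurable fun x : Fin C → ℝ => sorted x p := fun p =>
    (measurable_pi_apply p).comp (measurable_sorted C)
  have h : windowEvent C K i η =
      (⋂ (p : Fin C) (q : Fin C) (_ : (p : ℕ) + 1 = i) (_ : (q : ℕ) + 1 = K + i),
        {x | 2 * ((K : ℝ) / C - η) ≤ sorted x p + sorted x q}) ∩
      ⋂ (p : Fin C) (q : Fin C) (_ : (p : ℕ) + 2 = i) (_ : (q : ℕ) + 2 = K + i),
        {x | sorted x p + sorted x q ≤ 2 * (1 - (K : ℝ) / C + η)} := by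
    ext x; simp [windowEvent]
  rw [h]
  refine MeasurableSet.inter ?_ ?_
  · exact MeasurableSet.iInter fun p => MeasurableSet.iInter fun q => MeasurableSet.iInter fun _ =>
      MeasurableSet.iInter fun _ => measurableSet_le measurable_const ((hs p).add (hs q))
  · exact MeasurableSet.iInter fun p => MeasurableSet.iInter fun q => MeasurableSet.iInter fun _ =>
      MeasurableSet.iInter fun _ => measurableSet_le ((hs p).add (hs q)) measurable_const

theorem windowEvent_mono (C K i : ℕ) : Monotone (windowEvent C K i) := fun η η' hη x hx =>
  ⟨fun p q hp hq => le_trans (by linarith) (hx.1 p q hp hq),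
    fun p q hp hq => (hx.2 p q hp hq).trans (by linarith)⟩

theorem iInter_windowEvent (C K i : ℕ) :
    ⋂ n : ℕ, windowEvent C K i (1 / (n + 1)) = windowEvent C K i 0 := by
  refine Set.Subset.antisymm (fun x hx => ?_)
    (Set.subset_iInter fun n => windowEvent_mono C K i (by positivity))
  rw [Set.mem_iInter] at hx
  have hlim := tendsto_one_div_add_atTop_nhds_zero_nat (𝕜 := ℝ)
  constructor
  · intro p q hp hq
    exact le_of_tendsto' ((hlim.const_sub _).const_mul _) fun n => (hx n).1 p q hp hq
  · intro p q hp hq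
    exact ge_of_tendsto' ((hlim.const_add _).const_mul _) fun n => (hx n).2 p q hp hq

/-- The inequalities are closed, so the events decrease to the one with η = 0 and continuity from
above applies. -/
theorem tendsto_windowEvent (C K i : ℕ) :
    Tendsto (fun n : ℕ => (uniformLaw C).real (windowEvent C K i (1 / (n + 1)))) atTop
      (𝓝 ((uniformLaw C).real (windowEvent C K i 0))) := by
  have h := tendsto_measure_iInter_atTop (μ := uniformLaw C)
    (s := fun n : ℕ => windowEvent C K i (1 / (n + 1)))
    (fun n => (measurableSet_windowEvent C K i _).nullMeasurableSet)
    (fun a b hab => windowEvent_mono C K i (Nat.one_div_le_one_div hab))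
    ⟨0, measure_ne_top _ _⟩
  rw [iInter_windowEvent] at h
  exact (ENNReal.tendsto_toReal (measure_ne_top _ _)).comp h

theorem orderStat_eq_coe {n : ℕ} (x : Fin n → ℝ) {i : ℕ} (p : Fin n) (hp : (p : ℕ) + 1 = i) :
    orderStat x i = ((sorted x p : ℝ) : EReal) := by
  subst hp
  simp [orderStat, sorted]

theorem orderStat_eq_top {n : ℕ} (x : Fin n → ℝ) {i : ℕ} (hi : n < i) : orderStat x i = ⊤ := by
  unfold orderStat
  rw [if_neg (by omega), dif_neg (by omega)]

theorem coe_le_half_add_coe (k a b : ℝ) :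
    (k : EReal) ≤ ((a : EReal) + (b : EReal)) / 2 ↔ 2 * k ≤ a + b := by
  have : ((a : EReal) + (b : EReal)) / 2 = (((a + b) / 2 : ℝ) : EReal) := by
    rw [EReal.coe_div, EReal.coe_add]; rfl
  rw [this, EReal.coe_le_coe_iff, le_div_iff₀ (by norm_num), mul_comm]

theorem half_add_coe_le_coe (k a b : ℝ) :
    ((a : EReal) + (b : EReal)) / 2 ≤ (k : EReal) ↔ a + b ≤ 2 * k := by
  have : ((a : EReal) + (b : EReal)) / 2 = (((a + b) / 2 : ℝ) : EReal) := by
    rw [EReal.coe_div, EReal.coe_add]; rfl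
  rw [this, EReal.coe_le_coe_iff, div_le_iff₀ (by norm_num), mul_comm]

theorem orderStat_event_eq {C K i : ℕ} (hKC : K < C) (hK : 0 < K) (hi1 : 1 ≤ i)
    (hi2 : i ≤ C - K + 1) :
    {x : Fin C → ℝ | (((K : ℝ) / C : ℝ) : EReal) ≤ (orderStat x i + orderStat x (K + i)) / 2 ∧
        (orderStat x (i - 1) + orderStat x (K + i - 1)) / 2 ≤ ((1 - (K : ℝ) / C : ℝ) : EReal)} =
      windowEvent C K i 0 := by
  have h2 : (0 : EReal) < 2 := by norm_num
  have h2' : (2 : EReal) ≠ ⊤ := EReal.coe_ne_top 2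
  ext x
  refine and_congr ?_ ?_
  · rw [orderStat_eq_coe x (⟨i - 1, by omega⟩ : Fin C) (by simp; omega), sub_zero]
    by_cases h : K + i ≤ C
    · rw [orderStat_eq_coe x (⟨K + i - 1, by omega⟩ : Fin C) (by simp; omega), coe_le_half_add_coe]
      refine Iff.symm (forall_fin_pair_iff ?_ ?_) <;> simp <;> omega
    -- Only i = C - K + 1 leads here: the right neighbour of the window is at +∞.
    · rw [orderStat_eq_top x (by omega), EReal.coe_add_top, EReal.top_div_of_pos_ne_top h2 h2']
      refine iff_of_true le_top fun p q _ hq => ?_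
      omega
  · rw [orderStat_eq_coe (i := K + i - 1) x (⟨K + i - 2, by omega⟩ : Fin C) (by simp; omega),
      add_zero]
    by_cases h : i = 1
    · have : orderStat x (i - 1) = ⊥ := by simp [orderStat, h]
      rw [this, EReal.bot_add, EReal.bot_div_of_pos_ne_top h2 h2']
      refine iff_of_true bot_le fun p q hp _ => ?_
      omega
    · rw [orderStat_eq_coe (i := i - 1) x (⟨i - 2, by omega⟩ : Fin C) (by simp; omega),
        half_add_coe_le_coe]
      refine Iff.symm (forall_fin_pair_iff ?_ ?_) <;> simp <;> omega

theorem orderStatBound_eq_sum {C K : ℕ} (hKC : K < C) (hK : 0 < K) :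
    orderStatBound C K =
      ∑ i ∈ Finset.Icc 1 (C - K + 1), (uniformLaw C).real (windowEvent C K i 0) := by
  refine Finset.sum_congr rfl fun i hi => ?_
  rw [Finset.mem_Icc] at hi
  rw [orderStat_event_eq hKC hK hi.1 hi.2]

theorem measurePreserving_reflect (n : ℕ) :
    MeasurePreserving (fun (x : Fin n → ℝ) i => 1 - x i) (uniformLaw n) (uniformLaw n) := by
  have h : MeasurePreserving (fun t : ℝ => 1 - t) unitLaw unitLaw := by
    have h1 := (Measure.measurePreserving_sub_left (volume : Measure ℝ) 1).restrict_preimage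
      (measurableSet_Icc (a := (0 : ℝ)) (b := 1))
    have h2 : (fun t : ℝ => 1 - t) ⁻¹' Set.Icc 0 1 = Set.Icc 0 1 := by
      simp
    rwa [h2] at h1
  exact measurePreserving_pi _ _ fun _ => h

theorem sorted_reflect {n : ℕ} (x : Fin n → ℝ) (p : Fin n) :
    sorted (fun i => 1 - x i) p = 1 - sorted x p.rev := by
  have h1 : Monotone ((fun i => 1 - x i) ∘ (Fin.revPerm.trans (Tuple.sort x))) := by
    intro a b hab
    have := monotone_sorted x (Fin.rev_le_rev.2 hab)
    simp only [Function.comp_apply, Equiv.trans_apply, Fin.revPerm_apply]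
    simp only [sorted, Function.comp_apply] at this
    linarith
  rw [sorted_eq_of_monotone h1]
  rfl

theorem uniformLaw_windowEvent_first {C K : ℕ} (hCK : C < 2 * K) (hKC : K < C) :
    (uniformLaw C).real (windowEvent C K 1 0) = 2 ^ K * (1 - (K : ℝ) / C) ^ C := by
  -- X_1 and X_{K+1} are separated by m = K - 1 values, and h = C - K - 1 values lie above.
  obtain ⟨m, rfl⟩ : ∃ m, K = m + 1 := ⟨K - 1, by omega⟩
  obtain ⟨h, rfl⟩ : ∃ h, C = m + h + 2 := ⟨C - m - 2, by omega⟩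
  set κ : ℝ := ((m + 1 : ℕ) : ℝ) / ((m + h + 2 : ℕ) : ℝ) with hκ
  have hC : (0 : ℝ) < ((m + h + 2 : ℕ) : ℝ) := by positivity
  have hκ1 : 1 ≤ 2 * κ := by
    rw [hκ, ← mul_div_assoc, le_div_iff₀ hC, one_mul]; exact_mod_cast hCK.le
  have hκ2 : 2 * κ ≤ 2 := by
    have : κ ≤ 1 := (div_le_one hC).2 (by exact_mod_cast hKC.le)
    linarith
  have := uniformLaw_sorted_end m h hκ1 hκ2
  rw [mul_div_cancel_left₀ _ (two_ne_zero)] at this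
  rw [← this]
  congr 1
  ext x
  have h1 : x ∈ windowEvent (m + h + 2) (m + 1) 1 0 ↔
      2 * (κ - 0) ≤ sorted x ⟨0, by omega⟩ + sorted x ⟨m + 1, by omega⟩ :=
    (and_iff_left fun p q hp _ => by omega).trans (forall_fin_pair_iff rfl rfl)
  rw [h1, sub_zero]
  rfl

/-- The reflection t ↦ 1 - t preserves the law, reverses ranks, and exchanges the upper condition of
the last window with the lower condition of the first. -/
theorem uniformLaw_windowEvent_last {C K : ℕ} (hKC : K < C) :
    (uniformLaw C).real (windowEvent C K (C - K + 1) 0) =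
      (uniformLaw C).real (windowEvent C K 1 0) := by
  have h := (measurePreserving_reflect C).measureReal_preimage
    (measurableSet_windowEvent C K 1 0).nullMeasurableSet
  rw [← h]
  congr 1
  ext x
  constructor
  · intro hx
    refine ⟨fun p q hp hq => ?_, fun p q hp _ => by omega⟩
    have := hx.2 q.rev p.rev (by simp; omega) (by simp; omega)
    rw [sorted_reflect, sorted_reflect]
    linarith
  · intro hx
    refine ⟨fun p q hp hq => by omega, fun p q hp hq => ?_⟩
    have := hx.1 q.rev p.rev (by simp; omega) (by simp; omega)
    rw [sorted_reflect, sorted_reflect, Fin.rev_rev, Fin.rev_rev] at this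
    linarith

theorem uniformLaw_windowEvent_middle {C K i : ℕ} (hCK : C < 2 * K) (hKC : K < C) (hi2 : 2 ≤ i)
    (hiC : i ≤ C - K) :
    (uniformLaw C).real (windowEvent C K i 0) = tripleIntegralTerm C K i := by
  -- K ≥ 2 because 2 ≤ C - K < K. The block sizes are l = i - 2, m = K - 2 and h = C - K - i + 1,
  -- the last being positive as i ≤ C - K.
  obtain ⟨m, rfl⟩ : ∃ m, K = m + 2 := ⟨K - 2, by omega⟩
  obtain ⟨l, rfl⟩ : ∃ l, i = l + 2 := ⟨i - 2, by omega⟩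
  obtain ⟨h, rfl⟩ : ∃ h, C = l + m + h + 3 := ⟨C - l - m - 3, by omega⟩
  have hC : (0 : ℝ) < ((l + m + h + 3 : ℕ) : ℝ) := by positivity
  have hκ1 : 1 ≤ 2 * ((m + 2 : ℕ) : ℝ) / ((l + m + h + 3 : ℕ) : ℝ) := by
    rw [le_div_iff₀ hC, one_mul]; exact_mod_cast hCK.le
  have key := uniformLaw_sorted_middle l m (h := h) (by omega) hκ1 (p := ⟨l, by omega⟩)
    (q := ⟨l + 1, by omega⟩) (r := ⟨l + m + 2, by omega⟩) (t := ⟨l + m + 3, by omega⟩) rfl rfl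
    rfl rfl
  have e1 : l + m + h + 3 - (m + 2) - (l + 2) + 1 = h := by omega
  have e2 : 1 - 2 * ((m + 2 : ℕ) : ℝ) / ((l + m + h + 3 : ℕ) : ℝ) / 2 =
      1 - ((m + 2 : ℕ) : ℝ) / ((l + m + h + 3 : ℕ) : ℝ) := by ring
  have e3 : 3 - 2 * (2 * ((m + 2 : ℕ) : ℝ) / ((l + m + h + 3 : ℕ) : ℝ)) =
      3 - 4 * ((m + 2 : ℕ) : ℝ) / ((l + m + h + 3 : ℕ) : ℝ) := by ring
  unfold tripleIntegralTerm
  rw [e1, Nat.add_sub_cancel, Nat.add_sub_cancel, ← e2, ← e3, ← key]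
  congr 1
  ext x
  have h1 : x ∈ windowEvent (l + m + h + 3) (m + 2) (l + 2) 0 ↔
      2 * (((m + 2 : ℕ) : ℝ) / ((l + m + h + 3 : ℕ) : ℝ) - 0) ≤
        sorted x ⟨l + 1, by omega⟩ + sorted x ⟨l + m + 3, by omega⟩ ∧
      sorted x ⟨l, by omega⟩ + sorted x ⟨l + m + 2, by omega⟩ ≤
        2 * (1 - ((m + 2 : ℕ) : ℝ) / ((l + m + h + 3 : ℕ) : ℝ) + 0) :=
    and_congr (forall_fin_pair_iff (by simp) (by simp; omega))
      (forall_fin_pair_iff (by simp) (by simp; omega))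
  rw [h1, and_comm, Set.mem_ofPred_eq, sub_zero, add_zero, mul_sub, mul_one, mul_div_assoc]

theorem orderStatBound_eq {C K : ℕ} (hCK : C < 2 * K) (hKC : K < C) :
    orderStatBound C K = 2 ^ (K + 1) * (1 - (K : ℝ) / C) ^ C +
      ∑ i ∈ Finset.Icc 2 (C - K), tripleIntegralTerm C K i := by
  have hK : 0 < K := by omega
  have h1 : Finset.Icc 1 (C - K + 1) =
      insert 1 (insert (C - K + 1) (Finset.Icc 2 (C - K))) := by
    ext i; simp only [Finset.mem_Icc, Finset.mem_insert]; omega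
  rw [orderStatBound_eq_sum hKC hK, h1, Finset.sum_insert, Finset.sum_insert,
    uniformLaw_windowEvent_last hKC, uniformLaw_windowEvent_first hCK hKC,
    Finset.sum_congr rfl fun i hi => uniformLaw_windowEvent_middle hCK hKC
      (Finset.mem_Icc.1 hi).1 (Finset.mem_Icc.1 hi).2]
  · ring
  · simp
  · simp only [Finset.mem_insert, Finset.mem_Icc]; omega

/-! ### Audiences of creators under the user-centric algorithm -/

theorem le_midpoint_of_abs_le {θ u v : ℝ} (huv : u < v) (h : |θ - u| ≤ |θ - v|) :
    θ ≤ (u + v) / 2 := by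
  rcases le_total θ v with h1 | h1
  · rw [abs_of_nonpos (sub_nonpos.2 h1)] at h
    linarith [le_abs_self (θ - u)]
  · rw [abs_of_nonneg (sub_nonneg.2 h1)] at h
    linarith [le_abs_self (θ - u)]

theorem midpoint_le_of_abs_le {θ u v : ℝ} (huv : u < v) (h : |θ - v| ≤ |θ - u|) :
    (u + v) / 2 ≤ θ := by
  rcases le_total u θ with h1 | h1
  · rw [abs_of_nonneg (sub_nonneg.2 h1)] at h
    linarith [neg_abs_le (θ - v)]
  · rw [abs_of_nonpos (sub_nonpos.2 h1)] at h
    linarith [neg_abs_le (θ - v)]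

namespace Platform

variable {U C : ℕ} {M : Platform 2 U C} {R : RecSeq U C}

/-- The angles of the creators. -/
noncomputable def creatorAngles (M : Platform 2 U C) (j : Fin C) : ℝ := typeAngle (M.types.2 j)

/-- The angles of the users. -/
noncomputable def userAngles (M : Platform 2 U C) (i : Fin U) : ℝ := typeAngle (M.types.1 i)

theorem IsUserCentric.abs_le (hM : M.Valid) (h : M.IsUserCentric R) {i : Fin U} {j j' : Fin C}
    (hj : j ∈ R 0 i) (hj' : j' ∉ R 0 i) :
    |M.userAngles i - M.creatorAngles j| ≤ |M.userAngles i - M.creatorAngles j'| :=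
  (inner_le_inner_iff (hM.1 i) (hM.2 j') (hM.2 j)).1
    (h.eng_le (Finset.mem_univ i) hj (Finset.mem_univ j') hj')

/-- Pigeonhole: there are at least `K + 1` ranks from `a` to `b`, and a user sees at most `K`
creators. -/
theorem IsUserCentric.exists_notMem (h : M.IsUserCentric R) (i : Fin U)
    {a b : Fin C} (hab : (a : ℕ) + M.K ≤ b) (σ : Equiv.Perm (Fin C)) :
    ∃ c, a ≤ c ∧ c ≤ b ∧ σ c ∉ R 0 i := by
  by_contra! H
  have h1 : (Finset.Icc a b).map σ.toEmbedding ⊆ R 0 i := by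
    intro j hj
    obtain ⟨c, hc, rfl⟩ := Finset.mem_map.1 hj
    exact H c (Finset.mem_Icc.1 hc).1 (Finset.mem_Icc.1 hc).2
  have h2 := Finset.card_le_card h1
  rw [Finset.card_map, Fin.card_Icc] at h2
  have h3 := (h.feasible 0 i (Finset.mem_univ i)).2
  omega

/-- Some creator of rank `c` with a < c ≤ b is not shown. The user is no farther from `a` than from
`c`, hence left of their midpoint, which is at most the midpoint of `a` and `b`. -/
theorem IsUserCentric.userAngle_le (hM : M.Valid) (h : M.IsUserCentric R)
    (hinj : Function.Injective M.creatorAngles) {i : Fin U} {a b : Fin C}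
    (hab : (a : ℕ) + M.K ≤ b) (ha : Tuple.sort M.creatorAngles a ∈ R 0 i) :
    M.userAngles i ≤ (sorted M.creatorAngles a + sorted M.creatorAngles b) / 2 := by
  obtain ⟨c, hac, hcb, hc⟩ := h.exists_notMem i hab (Tuple.sort M.creatorAngles)
  have hne : a ≠ c := fun e => hc (e ▸ ha)
  have h1 := le_midpoint_of_abs_le (strictMono_sorted hinj (lt_of_le_of_ne hac hne))
    (h.abs_le hM ha hc)
  have h2 := monotone_sorted M.creatorAngles hcb
  linarith

theorem IsUserCentric.le_userAngle (hM : M.Valid) (h : M.IsUserCentric R)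
    (hinj : Function.Injective M.creatorAngles) {i : Fin U} {a b : Fin C}
    (hab : (a : ℕ) + M.K ≤ b) (hb : Tuple.sort M.creatorAngles b ∈ R 0 i) :
    (sorted M.creatorAngles a + sorted M.creatorAngles b) / 2 ≤ M.userAngles i := by
  obtain ⟨c, hac, hcb, hc⟩ := h.exists_notMem i hab (Tuple.sort M.creatorAngles)
  have hne : c ≠ b := fun e => hc (e ▸ hb)
  have h1 := midpoint_le_of_abs_le (strictMono_sorted hinj (lt_of_le_of_ne hcb hne))
    (h.abs_le hM hb hc)
  have h2 := monotone_sorted M.creatorAngles hac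
  linarith

open Classical in
/-- If `K` creators survive the first step, then their window can attract enough users. -/
theorem IsUserCentric.exists_windowEvent (hM : M.Valid) (h : M.IsUserCentric R)
    (hinj : Function.Injective M.creatorAngles) (hK : 0 < M.K)
    (hcard : M.K ≤ (M.creators R 1).card) {η : ℝ}
    (h1 : (Finset.univ.filter fun i => M.userAngles i ≤ (M.K : ℝ) / C - η).card < M.abar)
    (h2 : (Finset.univ.filter fun i => 1 - (M.K : ℝ) / C + η ≤ M.userAngles i).card < M.abar) :
    ∃ i ∈ Finset.Icc 1 (C - M.K + 1), M.creatorAngles ∈ windowEvent C M.K i η := by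
  set x := M.creatorAngles with hx
  -- The ranks of the creators that survive the first step.
  set P := (M.creators R 1).map (Tuple.sort x).symm.toEmbedding with hP
  have hPcard : M.K ≤ P.card := by rwa [hP, Finset.card_map]
  have hPne : P.Nonempty := Finset.card_pos.1 (hK.trans_le hPcard)
  have hmemP : ∀ a ∈ P, M.abar ≤ (Finset.univ.filter fun i => Tuple.sort x a ∈ R 0 i).card := by
    intro a ha
    obtain ⟨j, hj, rfl⟩ := Finset.mem_map.1 ha
    simpa [users_zero] using (mem_creators_succ.1 hj).2
  set lo := P.min' hPne with hlo
  set hi := P.max' hPne with hhi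
  have hspan : (lo : ℕ) + M.K ≤ hi + 1 := by
    have : P ⊆ Finset.Icc lo hi := fun a ha =>
      Finset.mem_Icc.2 ⟨P.min'_le a ha, P.le_max' a ha⟩
    have := Finset.card_le_card this
    rw [Fin.card_Icc] at this
    omega
  have hiC := hi.2
  -- The window starts at the lowest surviving rank; `windowEvent` counts ranks from 1.
  refine ⟨lo + 1, Finset.mem_Icc.2 ⟨by omega, by omega⟩, fun p q hp hq => ?_, fun p q hp hq => ?_⟩
  · obtain rfl : p = lo := Fin.ext (by omega)
    by_contra! hlt
    refine absurd (hmemP _ (P.min'_mem hPne)) (not_le.2 (lt_of_le_of_lt ?_ h1))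
    refine Finset.card_le_card fun i hi' => ?_
    rw [Finset.mem_filter] at hi' ⊢
    have := h.userAngle_le hM hinj (b := q) (by omega) hi'.2
    exact ⟨hi'.1, by linarith⟩
  · by_contra! hlt
    refine absurd (hmemP _ (P.max'_mem hPne)) (not_le.2 (lt_of_le_of_lt ?_ h2))
    refine Finset.card_le_card fun i hi' => ?_
    rw [Finset.mem_filter] at hi' ⊢
    -- The survivors may spread over more than `K` ranks. The midpoint is taken at `hi`, and then p
    -- ≤ hi - K and q ≤ hi give the required inequality for the window starting at `lo`.
    have h3 := h.le_userAngle hM hinj (a := ⟨hi - M.K, by omega⟩) (by simp only; omega) hi'.2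
    have h4 := monotone_sorted x (show p ≤ ⟨hi - M.K, by omega⟩ from Fin.le_def.2 (by simp only; omega))
    have h5 := monotone_sorted x (show q ≤ hi from Fin.le_def.2 (by omega))
    exact ⟨hi'.1, by linarith⟩

end Platform

open Classical in
/-- Chebyshev's inequality for the number of uniform variables in a set. -/
theorem uniformLaw_card_filter_le {n : ℕ} (hn : 0 < n) {A : Set ℝ} (hA : MeasurableSet A) {η : ℝ}
    (hη : 0 < η) :
    (uniformLaw n).real {x | n * (unitLaw.real A + η) ≤
        ((Finset.univ.filter fun i => x i ∈ A).card : ℝ)} ≤ 1 / (n * η ^ 2) := by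
  let X : Fin n → (Fin n → ℝ) → ℝ := fun i x => A.indicator 1 (x i)
  have hg : Measurable (A.indicator (1 : ℝ → ℝ)) := measurable_one.indicator hA
  have hmem : ∀ t, A.indicator (1 : ℝ → ℝ) t ∈ Set.Icc (0 : ℝ) 1 := fun t => by
    by_cases h : t ∈ A <;> simp [h]
  have hXm : ∀ i, Measurable (X i) := fun i => hg.comp (measurable_pi_apply i)
  have hmemLp : ∀ i, MemLp (X i) 2 (uniformLaw n) := fun i =>
    MemLp.of_bound (hXm i).aestronglyMeasurable 1 (Eventually.of_forall fun x => by
      rw [Real.norm_eq_abs, abs_le]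
      exact ⟨by linarith [(hmem (x i)).1], (hmem (x i)).2⟩)
  have hind : iIndepFun X (uniformLaw n) :=
    iIndepFun_pi (μ := fun _ : Fin n => unitLaw) (X := fun _ => A.indicator (1 : ℝ → ℝ))
      fun _ => hg.aemeasurable
  have hvar : variance (∑ i, X i) (uniformLaw n) ≤ n := by
    rw [IndepFun.variance_sum (fun i _ => hmemLp i) fun i _ j _ hij => hind.indepFun hij]
    calc ∑ i, variance (X i) (uniformLaw n) ≤ ∑ _i : Fin n, (1 : ℝ) := by
          refine Finset.sum_le_sum fun i _ => ?_
          have hb : ∀ᵐ x ∂uniformLaw n, X i x ∈ Set.Icc (0 : ℝ) 1 :=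
            Eventually.of_forall fun x => hmem (x i)
          -- A variable with values in [0, 1] has variance at most 1/4; the cruder bound 1 suffices.
          have hv := variance_le_sq_of_bounded hb (hXm i).aemeasurable
          norm_num at hv
          linarith
      _ = n := by simp
  have hmean : ∫ x, (∑ i, X i) x ∂uniformLaw n = n * unitLaw.real A := by
    simp only [Finset.sum_apply]
    rw [integral_finsetSum _ fun i _ => (hmemLp i).integrable (by norm_num)]
    have : ∀ i : Fin n, ∫ x, X i x ∂uniformLaw n = unitLaw.real A := by
      intro i
      have h1 := (measurePreserving_eval (fun _ : Fin n => unitLaw) i)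
      have h2 := integral_map (μ := uniformLaw n) h1.measurable.aemeasurable
        (f := A.indicator (1 : ℝ → ℝ)) (hg.aestronglyMeasurable)
      have h3 : (uniformLaw n).map (Function.eval i) = unitLaw := h1.map_eq
      rw [h3, integral_indicator_one hA] at h2
      exact h2.symm
    simp [this]
  have hsum : ∀ x, (∑ i, X i) x = ((Finset.univ.filter fun i => x i ∈ A).card : ℝ) := by
    intro x
    simp [X, Finset.sum_apply, Set.indicator_apply, Finset.sum_boole]
  have hn' : (0 : ℝ) < n := by exact_mod_cast hn
  have hc : 0 < n * η := by positivity
  have hcheb := meas_ge_le_variance_div_sq (memLp_finsetSum' Finset.univ fun i _ => hmemLp i) hc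
  have h1 : (uniformLaw n).real {x | n * (unitLaw.real A + η) ≤
        ((Finset.univ.filter fun i => x i ∈ A).card : ℝ)} ≤
      variance (∑ i, X i) (uniformLaw n) / (n * η) ^ 2 := by
    refine ENNReal.toReal_le_of_le_ofReal
      (div_nonneg (variance_nonneg _ _) (by positivity)) (le_trans (measure_mono ?_) hcheb)
    intro x hx
    rw [Set.mem_ofPred_eq, hmean, hsum]
    refine le_trans ?_ (le_abs_self _)
    rw [Set.mem_ofPred_eq] at hx
    linarith
  refine h1.trans ((div_le_div_of_nonneg_right hvar (by positivity)).trans (le_of_eq ?_))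
  field_simp

/-! ### Random types: null sets and measurability -/

/-- The platform with given parameters, as a function of the types. -/
def Platform.withTypes {D U C : ℕ} (K abar : ℕ) (ebar : ℝ) (ω : TypeSample D U C) :
    Platform D U C := { K := K, abar := abar, ebar := ebar, types := ω }

namespace Platform

variable {U C K abar : ℕ} {ebar : ℝ}

instance isProbabilityMeasure_typeLaw : IsProbabilityMeasure (typeLaw 2 U C) := by
  unfold typeLaw; infer_instance

theorem measurePreserving_angles (U C : ℕ) :
    MeasurePreserving (fun ω : TypeSample 2 U C =>
        ((fun i => typeAngle (ω.1 i), fun j => typeAngle (ω.2 j)) : (Fin U → ℝ) × (Fin C → ℝ)))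
      (typeLaw 2 U C) ((uniformLaw U).prod (uniformLaw C)) :=
  (measurePreserving_typeAngle U).prod (measurePreserving_typeAngle C)

theorem measurePreserving_userAngles (U C : ℕ) :
    MeasurePreserving (fun (ω : TypeSample 2 U C) i => typeAngle (ω.1 i))
      (typeLaw 2 U C) (uniformLaw U) :=
  measurePreserving_fst.comp (measurePreserving_angles U C)

theorem measurePreserving_creatorAngles (U C : ℕ) :
    MeasurePreserving (fun (ω : TypeSample 2 U C) j => typeAngle (ω.2 j))
      (typeLaw 2 U C) (uniformLaw C) :=
  measurePreserving_snd.comp (measurePreserving_angles U C)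

theorem ae_valid : ∀ᵐ ω ∂typeLaw 2 U C, (withTypes K abar ebar ω).Valid := by
  have h : ∀ n : ℕ, ∀ᵐ x ∂Measure.pi fun _ : Fin n => uniformType 2, ∀ i, IsTypeVector (x i) :=
    fun n => ae_all_iff.2 fun i => Measure.tendsto_eval_ae_ae.eventually ae_isTypeVector
  have h1 : ∀ᵐ ω ∂typeLaw 2 U C, ∀ i, IsTypeVector (ω.1 i) :=
    Measure.quasiMeasurePreserving_fst.ae (h U)
  have h2 : ∀ᵐ ω ∂typeLaw 2 U C, ∀ j, IsTypeVector (ω.2 j) :=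
    Measure.quasiMeasurePreserving_snd.ae (h C)
  filter_upwards [h1, h2] with ω h1 h2 using ⟨h1, h2⟩

theorem ae_injective_creatorAngles :
    ∀ᵐ ω ∂typeLaw 2 U C, Function.Injective (withTypes K abar ebar ω).creatorAngles :=
  (measurePreserving_creatorAngles U C).quasiMeasurePreserving.ae (ae_injective_uniformLaw C)

/-- By Fubini: for fixed creators, the user angles in question form a null hyperplane. -/
theorem ae_userAngle_ne (i : Fin U) (j j' : Fin C) :
    ∀ᵐ ω ∂typeLaw 2 U C, typeAngle (ω.1 i) ≠ (typeAngle (ω.2 j) + typeAngle (ω.2 j')) / 2 := by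
  have h : ∀ᵐ p ∂(uniformLaw U).prod (uniformLaw C), p.1 i ≠ (p.2 j + p.2 j') / 2 := by
    have hm : MeasurableSet {p : (Fin U → ℝ) × (Fin C → ℝ) | p.1 i = (p.2 j + p.2 j') / 2} :=
      measurableSet_eq_fun (by fun_prop) (by fun_prop)
    rw [ae_iff]
    simp only [ne_eq, not_not]
    rw [Measure.prod_apply_symm hm, lintegral_eq_zero_iff' (measurable_measure_prodMk_right
      hm).aemeasurable]
    refine Eventually.of_forall fun x => ?_
    have := Measure.pi_hyperplane (fun _ : Fin U => unitLaw) i ((x j + x j') / 2)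
    exact this
  exact (measurePreserving_angles U C).quasiMeasurePreserving.ae h

/-- A tie means equal distances, so either the two creators have the same angle or the user sits at
their midpoint; both are null events. -/
theorem ae_injective_eng :
    ∀ᵐ ω ∂typeLaw 2 U C, ∀ i, Function.Injective ((withTypes K abar ebar ω).eng i) := by
  have h : ∀ᵐ ω ∂typeLaw 2 U C, ∀ (i : Fin U) (j j' : Fin C),
      typeAngle (ω.1 i) ≠ (typeAngle (ω.2 j) + typeAngle (ω.2 j')) / 2 :=
    ae_all_iff.2 fun i => ae_all_iff.2 fun j => ae_all_iff.2 fun j' => ae_userAngle_ne i j j'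
  filter_upwards [h, ae_valid (K := K) (abar := abar) (ebar := ebar),
    ae_injective_creatorAngles (K := K) (abar := abar) (ebar := ebar)] with ω h1 h2 h3 i j j' hjj
  have h4 := (inner_le_inner_iff (h2.1 i) (h2.2 j) (h2.2 j')).1 hjj.le
  have h5 := (inner_le_inner_iff (h2.1 i) (h2.2 j') (h2.2 j)).1 hjj.ge
  rcases abs_eq_abs.1 (le_antisymm h4 h5) with h6 | h6
  · exact h3 (show typeAngle _ = typeAngle _ by simpa using h6.symm)
  · refine absurd ?_ (h1 i j j')
    simp only [withTypes] at h6
    linarith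

theorem measurable_eng (i : Fin U) (j : Fin C) :
    Measurable fun ω : TypeSample 2 U C => (withTypes K abar ebar ω).eng i j :=
  ((measurable_pi_apply i).comp measurable_fst).inner ((measurable_pi_apply j).comp measurable_snd)

theorem measurable_value (A : Fin U → Finset (Fin C)) :
    Measurable fun ω : TypeSample 2 U C => (withTypes K abar ebar ω).value A :=
  Finset.measurable_fun_sum _ fun i _ => Finset.measurable_fun_sum _ fun j _ => measurable_eng i j

theorem measurableSet_isStable (A : Fin U → Finset (Fin C)) :
    MeasurableSet {ω : TypeSample 2 U C | (withTypes K abar ebar ω).IsStable A} := by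
  have h : Measurable fun ω : TypeSample 2 U C => (withTypes K abar ebar ω).IsStable A := by
    refine Measurable.and (Measurable.forall fun i => ?_)
      (measurable_const : Measurable fun _ : TypeSample 2 U C => ∀ i, ∀ j ∈ A i,
        abar ≤ (Finset.univ.filter fun i' => j ∈ A i').card)
    refine Measurable.or measurable_const (Measurable.and
      (measurable_const : Measurable fun _ : TypeSample 2 U C => (A i).card = K) ?_)
    refine Measurable.forall fun j => Measurable.imp measurable_const ?_
    exact measurableSet_setOfPred.1 (measurableSet_le measurable_const (measurable_eng i j))
  exact measurableSet_setOfPred.2 h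

theorem measurable_optimum :
    Measurable fun ω : TypeSample 2 U C => (withTypes K abar ebar ω).optimum := by
  classical
  have h := Finset.measurable_sup' (Finset.univ_nonempty (α := Fin U → Finset (Fin C)))
    (f := fun A (ω : TypeSample 2 U C) =>
      if (withTypes K abar ebar ω).IsStable A then (withTypes K abar ebar ω).value A else 0)
    fun A _ => Measurable.ite (measurableSet_isStable A) (measurable_value A) measurable_const
  convert h using 1
  funext ω
  rw [Finset.sup'_apply, optimum]

/-- The possible outcomes of the comparisons. -/
abbrev Comparisons (U C : ℕ) : Type := (Fin U → Fin C → Fin C → Prop) × (Fin U → Fin C → Prop)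

/-- The comparisons that determine the recommendations of the user-centric algorithm. -/
def comparisons (K abar : ℕ) (ebar : ℝ) (ω : TypeSample 2 U C) :
    Comparisons U C :=
  (fun i j j' => (withTypes K abar ebar ω).eng i j ≤ (withTypes K abar ebar ω).eng i j',
    fun i j => ebar ≤ (withTypes K abar ebar ω).eng i j)

theorem measurable_comparisons :
    Measurable (comparisons K abar ebar : TypeSample 2 U C → _) := by
  refine Measurable.prodMk ?_ ?_
  · exact measurable_pi_lambda _ fun i => measurable_pi_lambda _ fun j => measurable_pi_lambda _
      fun j' => measurableSet_setOfPred.1 (measurableSet_le (measurable_eng i j) (measurable_eng i j'))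
  · exact measurable_pi_lambda _ fun i => measurable_pi_lambda _ fun j =>
      measurableSet_setOfPred.1 (measurableSet_le measurable_const (measurable_eng i j))

theorem sameOrder_of_comparisons_eq {ω ω' : TypeSample 2 U C}
    (h : comparisons K abar ebar ω = comparisons K abar ebar ω') :
    (withTypes K abar ebar ω).SameOrder (withTypes K abar ebar ω') := by
  obtain ⟨h1, h2⟩ := Prod.ext_iff.1 h
  exact ⟨rfl, rfl, fun i j j' => (congrFun (congrFun (congrFun h1 i) j) j').to_iff,
    fun i j => (congrFun (congrFun h2 i) j).to_iff⟩

theorem measurable_value_prod (A : Comparisons U C → Fin U → Finset (Fin C)) :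
    Measurable fun p : Comparisons U C × TypeSample 2 U C =>
      (withTypes K abar ebar p.2).value (A p.1) :=
  measurable_from_prod_countable_right fun d => measurable_value (A d)

theorem measurable_value_comparisons (A : Comparisons U C → Fin U → Finset (Fin C)) :
    Measurable fun ω : TypeSample 2 U C =>
      (withTypes K abar ebar ω).value (A (comparisons K abar ebar ω)) :=
  Measurable.comp (g := fun p : Comparisons U C × TypeSample 2 U C =>
      (withTypes K abar ebar p.2).value (A p.1)) (f := fun ω => (comparisons K abar ebar ω, ω))
    (measurable_value_prod A) (measurable_comparisons.prodMk measurable_id)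

/-- `UC` is an arbitrary selection. Off the null set of ties, each of the finitely many outcomes of
the comparisons fixes a limiting assignment, read off from any one sample with that outcome, and the
value of a fixed assignment is measurable. -/
theorem aemeasurable_userCentric {UC : TypeSample 2 U C → RecSeq U C}
    (hUC : ∀ ω, (withTypes K abar ebar ω).Valid → (withTypes K abar ebar ω).IsUserCentric (UC ω)) :
    AEMeasurable (fun ω => (withTypes K abar ebar ω).longTermEngagement (UC ω))
      (typeLaw 2 U C) := by
  classical
  let Good : TypeSample 2 U C → Prop := fun ω => (withTypes K abar ebar ω).Valid ∧
    ∀ i, Function.Injective ((withTypes K abar ebar ω).eng i)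
  have hA : ∀ d, ∃ A : Fin U → Finset (Fin C), ∀ ω, Good ω → comparisons K abar ebar ω = d →
      (withTypes K abar ebar ω).longTermEngagement (UC ω) = (withTypes K abar ebar ω).value A := by
    intro d
    by_cases h : ∃ ω, Good ω ∧ comparisons K abar ebar ω = d
    · obtain ⟨ω₀, h1, h2⟩ := h
      obtain ⟨A, hA⟩ := (hUC ω₀ h1.1).exists_limit h1.2
      exact ⟨A, fun ω hω hd => hA _ _ (sameOrder_of_comparisons_eq (h2.trans hd.symm))
        (hUC ω hω.1)⟩
    · exact ⟨fun _ => ∅, fun ω h1 h2 => absurd ⟨ω, h1, h2⟩ h⟩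
  choose A hA using hA
  refine ⟨fun ω => (withTypes K abar ebar ω).value (A (comparisons K abar ebar ω)),
    measurable_value_comparisons A, ?_⟩
  filter_upwards [ae_valid (K := K) (abar := abar) (ebar := ebar),
    ae_injective_eng (K := K) (abar := abar) (ebar := ebar)] with ω h1 h2
  exact hA _ ω ⟨h1, h2⟩ rfl

theorem aemeasurable_forwardLooking (hK : 0 < K) {FL : TypeSample 2 U C → RecSeq U C}
    (hFL : ∀ ω, (withTypes K abar ebar ω).Valid →
      (withTypes K abar ebar ω).IsForwardLooking (FL ω)) :
    AEMeasurable (fun ω => (withTypes K abar ebar ω).longTermEngagement (FL ω))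
      (typeLaw 2 U C) := by
  refine ⟨_, measurable_optimum (K := K) (abar := abar) (ebar := ebar), ?_⟩
  filter_upwards [ae_valid (K := K) (abar := abar) (ebar := ebar)] with ω h
  exact (hFL ω h).longTermEngagement_eq h hK

end Platform

/-! ### Conditioning on positive engagement -/

section Conditioning

variable {Ω : Type*} [MeasurableSpace Ω] {μ : Measure Ω} [IsProbabilityMeasure μ] {E f : Ω → ℝ}

/-- The inequality needs only subadditivity, so the level sets of `E` need not be measurable. -/
theorem one_sub_le_measureReal_pos (hE : ∀ᵐ ω ∂μ, 0 ≤ E ω) :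
    1 - μ.real {ω | E ω = 0} ≤ μ.real {ω | 0 < E ω} := by
  have h1 : μ.real ({ω | E ω = 0} ∪ {ω | 0 < E ω}) = 1 := by
    have : ({ω | E ω = 0} ∪ {ω | 0 < E ω} : Set Ω) =ᵐ[μ] Set.univ := by
      refine eventuallyEq_univ.2 ?_
      filter_upwards [hE] with ω hω
      exact hω.eq_or_lt.imp Eq.symm id
    rw [measureReal_congr this, probReal_univ]
  have h2 := measureReal_union_le (μ := μ) {ω | E ω = 0} {ω | 0 < E ω}
  linarith

theorem isProbabilityMeasure_cond_pos (hE : ∀ᵐ ω ∂μ, 0 ≤ E ω) (h : μ.real {ω | E ω = 0} < 1) :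
    IsProbabilityMeasure (cond μ {ω | 0 < E ω}) := by
  refine cond_isProbabilityMeasure fun h0 => ?_
  have := one_sub_le_measureReal_pos hE
  rw [measureReal_def μ {ω | 0 < E ω}, h0] at this
  simp at this
  linarith

/-- Domination by an indicator turns the conditional mean into a conditional probability. `W` is
replaced by a measurable hull of the same measure, so that its indicator can be integrated. -/
theorem integral_cond_pos_le (hE : ∀ᵐ ω ∂μ, 0 ≤ E ω) (h : μ.real {ω | E ω = 0} < 1)
    (hf : Integrable f (cond μ {ω | 0 < E ω})) {W : Set Ω}
    (hfW : ∀ᵐ ω ∂μ, f ω ≤ (toMeasurable μ W).indicator 1 ω) :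
    ∫ ω, f ω ∂cond μ {ω | 0 < E ω} ≤ 1 / (1 - μ.real {ω | E ω = 0}) * μ.real W := by
  have hW := measurableSet_toMeasurable μ W
  have := isProbabilityMeasure_cond_pos hE h
  have hs := one_sub_le_measureReal_pos hE
  have h0 : 0 < 1 - μ.real {ω | E ω = 0} := by linarith
  calc ∫ ω, f ω ∂cond μ {ω | 0 < E ω}
      ≤ ∫ ω, (toMeasurable μ W).indicator 1 ω ∂cond μ {ω | 0 < E ω} :=
        integral_mono_ae hf ((integrable_const (1 : ℝ)).indicator hW)
          (cond_absolutelyContinuous.ae_le hfW)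
    _ = (μ.real {ω | 0 < E ω})⁻¹ * μ.real ({ω | 0 < E ω} ∩ toMeasurable μ W) := by
        rw [integral_indicator_one hW, measureReal_def, cond_apply' hW, ENNReal.toReal_mul,
          ENNReal.toReal_inv]
        rfl
    _ ≤ (1 - μ.real {ω | E ω = 0})⁻¹ * μ.real W := by
        refine mul_le_mul (inv_anti₀ h0 hs) ?_ measureReal_nonneg (inv_nonneg.2 h0.le)
        refine (measureReal_mono Set.inter_subset_right).trans (le_of_eq ?_)
        rw [measureReal_def, measure_toMeasurable, measureReal_def]
    _ = _ := by rw [one_div]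

end Conditioning

/-! ### Survival probability and the limit -/

namespace Platform

/-- Take `W` to be the union of the window events and the two events that too many users crowd into
an end interval of length K/C - η. Outside the crowding events, survival forces a window event. -/
theorem exists_survival_event {C K : ℕ} (hKC : K < C) (hK : 0 < K) (ebar : ℝ) {r : ℕ}
    (hr : 0 < r) {UC : TypeSample 2 (r * C) C → RecSeq (r * C) C}
    (hUC : ∀ ω, (withTypes K (r * K) ebar ω).Valid →
      (withTypes K (r * K) ebar ω).IsUserCentric (UC ω)) {η : ℝ} (hη : 0 < η)
    (hη' : η ≤ (K : ℝ) / C) :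
    ∃ W : Set (TypeSample 2 (r * C) C),
      (∀ᵐ ω ∂typeLaw 2 (r * C) C,
        (withTypes K (r * K) ebar ω).longTermEngagement (UC ω) ≠ 0 → ω ∈ W) ∧
      (typeLaw 2 (r * C) C).real W ≤
        ∑ i ∈ Finset.Icc 1 (C - K + 1), (uniformLaw C).real (windowEvent C K i η) +
          2 * (1 / (((r * C : ℕ) : ℝ) * η ^ 2)) := by
  classical
  have hC : (0 : ℝ) < C := by exact_mod_cast (Nat.zero_le K).trans_lt hKC
  have hκ1 : (K : ℝ) / C ≤ 1 := (div_le_one hC).2 (by exact_mod_cast hKC.le)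
  have hn : 0 < r * C := Nat.mul_pos hr (by omega)
  let κ : ℝ := (K : ℝ) / C
  let B : Set ℝ → Set (Fin (r * C) → ℝ) := fun A =>
    {x | ((r * C : ℕ) : ℝ) * (unitLaw.real A + η) ≤
      ((Finset.univ.filter fun i => x i ∈ A).card : ℝ)}
  let A₁ : Set ℝ := Set.Iic (κ - η)
  let A₂ : Set ℝ := Set.Ici (1 - κ + η)
  have hA₁ : unitLaw.real A₁ = κ - η := by
    have : Set.Iic (κ - η) =ᵐ[unitLaw] Set.Iio (κ - η) := Iio_ae_eq_Iic.symm
    rw [measureReal_congr this, unitLaw_real_Iio] <;> simp only [κ] <;> linarith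
  have hA₂ : unitLaw.real A₂ = κ - η := by
    have : Set.Ici (1 - κ + η) =ᵐ[unitLaw] Set.Ioi (1 - κ + η) := Ioi_ae_eq_Ici.symm
    rw [measureReal_congr this, unitLaw_real_Ioi] <;> simp only [κ] <;> linarith
  -- The mean fraction κ - η plus the slack η equals K/C, so the Chebyshev threshold is exactly the
  -- required audience rK.
  have hload : ∀ A, unitLaw.real A = κ - η →
      ((r * C : ℕ) : ℝ) * (unitLaw.real A + η) = ((r * K : ℕ) : ℝ) := by
    intro A hA
    rw [hA]
    simp only [κ]
    push_cast
    field_simp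
    ring
  let xs : TypeSample 2 (r * C) C → Fin C → ℝ := fun ω j => typeAngle (ω.2 j)
  let θs : TypeSample 2 (r * C) C → Fin (r * C) → ℝ := fun ω i => typeAngle (ω.1 i)
  refine ⟨(⋃ i ∈ Finset.Icc 1 (C - K + 1), xs ⁻¹' windowEvent C K i η) ∪
    (θs ⁻¹' B A₁ ∪ θs ⁻¹' B A₂), ?_, ?_⟩
  · filter_upwards [ae_valid (K := K) (abar := r * K) (ebar := ebar),
      ae_injective_creatorAngles (K := K) (abar := r * K) (ebar := ebar)] with ω hv hinj hne
    have huc := hUC ω hv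
    by_contra hW
    simp only [Set.mem_union, not_or] at hW
    obtain ⟨hW1, hW2, hW3⟩ := hW
    refine hW1 ?_
    have hlt : ∀ A, unitLaw.real A = κ - η → ω ∉ θs ⁻¹' B A →
        (Finset.univ.filter fun i => θs ω i ∈ A).card < r * K := by
      intro A hA hB
      have h1 : ¬ ((r * C : ℕ) : ℝ) * (unitLaw.real A + η) ≤
        ((Finset.univ.filter fun i => θs ω i ∈ A).card : ℝ) := hB
      rw [hload A hA] at h1
      exact_mod_cast not_le.1 h1
    obtain ⟨i, hi, hx⟩ := huc.exists_windowEvent hv hinj hK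
      (le_of_not_gt fun h => hne (huc.longTermEngagement_eq_zero h)) (η := η)
      (hlt A₁ hA₁ hW2) (hlt A₂ hA₂ hW3)
    exact Set.mem_iUnion₂.2 ⟨i, hi, hx⟩
  · have hθ := measurePreserving_userAngles (r * C) C
    have hx := measurePreserving_creatorAngles (r * C) C
    have hB : ∀ A, MeasurableSet A →
        (typeLaw 2 (r * C) C).real (θs ⁻¹' B A) ≤ 1 / (((r * C : ℕ) : ℝ) * η ^ 2) := by
      intro A hA
      refine le_trans ?_ (uniformLaw_card_filter_le hn hA hη)
      refine ENNReal.toReal_mono (measure_ne_top _ _) ?_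
      rw [← hθ.map_eq]
      exact Measure.le_map_apply hθ.measurable.aemeasurable _
    refine (measureReal_union_le _ _).trans (add_le_add ?_ ?_)
    · refine (measureReal_biUnion_finset_le _ _).trans (Finset.sum_le_sum fun i _ => le_of_eq ?_)
      exact hx.measureReal_preimage (measurableSet_windowEvent C K i η).nullMeasurableSet
    · refine (measureReal_union_le _ _).trans ?_
      rw [two_mul]
      exact add_le_add (hB _ measurableSet_Iic) (hB _ measurableSet_Ici)

/-- The probability that the user-centric algorithm keeps creators is asymptotically at most
`orderStatBound C K`. -/
theorem eventually_exists_survival_event {C K : ℕ} (hKC : K < C) (hK : 0 < K) (ebar : ℝ)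
    {UC : (r : ℕ) → TypeSample 2 (r * C) C → RecSeq (r * C) C}
    (hUC : ∀ r ω, (withTypes K (r * K) ebar ω).Valid →
      (withTypes K (r * K) ebar ω).IsUserCentric (UC r ω)) {δ : ℝ} (hδ : 0 < δ) :
    ∀ᶠ r in atTop, ∃ W : Set (TypeSample 2 (r * C) C),
      (∀ᵐ ω ∂typeLaw 2 (r * C) C,
        (withTypes K (r * K) ebar ω).longTermEngagement (UC r ω) ≠ 0 → ω ∈ W) ∧
      (typeLaw 2 (r * C) C).real W ≤ orderStatBound C K + δ := by
  have hC : (0 : ℝ) < C := by exact_mod_cast (Nat.zero_le K).trans_lt hKC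
  have hK' : (0 : ℝ) < K := by exact_mod_cast hK
  have hsum : Tendsto (fun n : ℕ => ∑ i ∈ Finset.Icc 1 (C - K + 1),
      (uniformLaw C).real (windowEvent C K i (1 / (n + 1)))) atTop (𝓝 (orderStatBound C K)) := by
    rw [orderStatBound_eq_sum hKC hK]
    exact tendsto_finsetSum _ fun i _ => tendsto_windowEvent C K i
  have h1 := hsum.eventually_lt_const (show orderStatBound C K < orderStatBound C K + δ / 2 by
    linarith)
  have h2 := (tendsto_one_div_add_atTop_nhds_zero_nat (𝕜 := ℝ)).eventually_le_const
    (show (0 : ℝ) < (K : ℝ) / C by positivity)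
  -- First η is fixed so that enlarging the windows costs less than δ/2; only then does r grow, to
  -- make the Chebyshev terms at most δ/2.
  obtain ⟨n, hn1, hn2⟩ := (h1.and h2).exists
  have hη : (0 : ℝ) < 1 / (n + 1) := by positivity
  set η : ℝ := 1 / (n + 1) with hηdef
  have h3 : Tendsto (fun r : ℕ => 2 * (1 / (((r * C : ℕ) : ℝ) * η ^ 2))) atTop (𝓝 0) := by
    have h4 : Tendsto (fun r : ℕ => ((r * C : ℕ) : ℝ) * η ^ 2) atTop atTop := by
      have : Tendsto (fun r : ℕ => (r : ℝ) * (C * η ^ 2)) atTop atTop :=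
        tendsto_natCast_atTop_atTop.atTop_mul_const (by positivity)
      refine this.congr fun r => ?_
      push_cast; ring
    simpa using (h4.inv_tendsto_atTop).const_mul 2
  filter_upwards [h3.eventually_le_const (half_pos hδ), eventually_gt_atTop 0] with r hr1 hr0
  obtain ⟨W, hW1, hW2⟩ := exists_survival_event hKC hK ebar hr0 (hUC r) hη hn2
  exact ⟨W, hW1, hW2.trans (by linarith)⟩

end Platform

/-- For small t > 0, eventually ε r < limsup ε + t < 1, and the bound increases with ε r; then t
tends to 0 from the right. The bounds on ε and ρ are what upper limits in ℝ require. -/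
theorem limsup_le_of_eventually_le_mul {ρ ε : ℕ → ℝ} {S : ℝ} (hS : 0 ≤ S)
    (hε1 : ∀ r, ε r ≤ 1) (hρ : ∀ r, 0 ≤ ρ r)
    (h : ∀ δ > 0, ∀ᶠ r in atTop, ε r < 1 → ρ r ≤ 1 / (1 - ε r) * (S + δ))
    (hlim : limsup ε atTop < 1) :
    limsup ρ atTop ≤ 1 / (1 - limsup ε atTop) * S := by
  set e := limsup ε atTop with he
  have hbdd : IsBoundedUnder (· ≤ ·) atTop ε := isBoundedUnder_of ⟨1, hε1⟩
  have key : ∀ t > 0, t < 1 - e → limsup ρ atTop ≤ 1 / (1 - (e + t)) * (S + t) := by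
    intro t ht ht1
    have h1 : ∀ᶠ r in atTop, ε r < e + t := eventually_lt_of_limsup_lt (by linarith) hbdd
    refine limsup_le_of_le (isCoboundedUnder_le_of_le atTop hρ) ?_
    filter_upwards [h1, h t ht] with r hr1 hr2
    refine (hr2 (by linarith)).trans ?_
    refine mul_le_mul_of_nonneg_right ?_ (by linarith)
    exact one_div_le_one_div_of_le (by linarith) (by linarith)
  have hcont : Tendsto (fun t : ℝ => 1 / (1 - (e + t)) * (S + t)) (𝓝[>] 0)
      (𝓝 (1 / (1 - (e + 0)) * (S + 0))) := by
    refine Tendsto.mono_left ?_ nhdsWithin_le_nhds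
    refine ContinuousAt.tendsto (f := fun t : ℝ => 1 / (1 - (e + t)) * (S + t)) ?_
    refine ContinuousAt.mul (ContinuousAt.div continuousAt_const (by fun_prop) ?_) (by fun_prop)
    rw [add_zero]; exact (sub_pos.2 hlim).ne'
  rw [add_zero, add_zero] at hcont
  refine ge_of_tendsto hcont ?_
  filter_upwards [Ioo_mem_nhdsGT (sub_pos.2 hlim)] with t ht using key t ht.1 ht.2

theorem orderStatBound_nonneg (C K : ℕ) : 0 ≤ orderStatBound C K :=
  Finset.sum_nonneg fun _ _ => measureReal_nonneg

open Platform in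
theorem mainTheorem5 (C K : ℕ) (hCK : C < 2 * K) (hKC : K < C)
    (ebar : ℝ) (hebar₀ : 0 ≤ ebar) (hebar₁ : ebar ≤ 1)
    (M : (r : ℕ) → TypeSample 2 (r * C) C → Platform 2 (r * C) C)
    (hM : ∀ r ω, M r ω = { K := K, abar := r * K, ebar := ebar, types := ω })
    (UC FL : (r : ℕ) → TypeSample 2 (r * C) C → RecSeq (r * C) C)
    (hUC : ∀ r ω, (M r ω).Valid → (M r ω).IsUserCentric (UC r ω))
    (hFL : ∀ r ω, (M r ω).Valid → (M r ω).IsForwardLooking (FL r ω))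
    (eps : ℕ → ℝ)
    (heps : ∀ r, eps r =
      (typeLaw 2 (r * C) C).real {ω | (M r ω).longTermEngagement (FL r ω) = 0})
    (ratio : (r : ℕ) → TypeSample 2 (r * C) C → ℝ)
    (hratio : ∀ r ω, ratio r ω =
      (M r ω).longTermEngagement (UC r ω) / (M r ω).longTermEngagement (FL r ω))
    (condLaw : (r : ℕ) → Measure (TypeSample 2 (r * C) C))
    (hcondLaw : ∀ r, condLaw r =
      ProbabilityTheory.cond (typeLaw 2 (r * C) C)
        {ω | 0 < (M r ω).longTermEngagement (FL r ω)}) :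
    (∀ r, eps r < 1 → IsProbabilityMeasure (condLaw r) ∧ Integrable (ratio r) (condLaw r)) ∧
    (∀ δ > 0, ∀ᶠ r in atTop, eps r < 1 →
      ∫ ω, ratio r ω ∂(condLaw r) ≤ 1 / (1 - eps r) * (orderStatBound C K + δ)) ∧
    (limsup eps atTop < 1 →
      limsup (fun r => ∫ ω, ratio r ω ∂(condLaw r)) atTop
        ≤ 1 / (1 - limsup eps atTop) * orderStatBound C K) ∧
    orderStatBound C K =
      2 ^ (K + 1) * (1 - (K : ℝ) / C) ^ C +
        ∑ i ∈ Finset.Icc 2 (C - K), tripleIntegralTerm C K i := by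
  have hK : 0 < K := by omega
  obtain rfl : M = fun r ω => withTypes K (r * K) ebar ω := by
    funext r ω; exact hM r ω
  have hE : ∀ r, ∀ᵐ ω ∂typeLaw 2 (r * C) C,
      0 ≤ (withTypes K (r * K) ebar ω).longTermEngagement (FL r ω) := fun r => by
    filter_upwards [ae_valid (K := K) (abar := r * K) (ebar := ebar)] with ω hv
    exact hv.longTermEngagement_nonneg _
  have hr01 : ∀ r, ∀ᵐ ω ∂typeLaw 2 (r * C) C, 0 ≤ ratio r ω ∧ ratio r ω ≤ 1 := fun r => by
    filter_upwards [ae_valid (K := K) (abar := r * K) (ebar := ebar)] with ω hv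
    rw [hratio]
    have h1 := hv.longTermEngagement_nonneg (UC r ω)
    have h2 := hv.longTermEngagement_nonneg (FL r ω)
    -- The quotient is 0 by convention where the denominator vanishes, so the bounds hold without
    -- conditioning.
    exact ⟨div_nonneg h1 h2, div_le_one_of_le₀ ((hFL r ω hv).2 _ (hUC r ω hv).feasible) h2⟩
  have hac : ∀ r, condLaw r ≪ typeLaw 2 (r * C) C := fun r => by
    rw [hcondLaw]; exact cond_absolutelyContinuous
  have hprob : ∀ r, eps r < 1 → IsProbabilityMeasure (condLaw r) := fun r hr => by
    rw [hcondLaw]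
    exact isProbabilityMeasure_cond_pos (hE r) (heps r ▸ hr)
  have hint : ∀ r, eps r < 1 → Integrable (ratio r) (condLaw r) := fun r hr => by
    have := hprob r hr
    have hm : AEMeasurable (ratio r) (typeLaw 2 (r * C) C) :=
      ((aemeasurable_userCentric (hUC r)).div
        (aemeasurable_forwardLooking hK (hFL r))).congr
          (Eventually.of_forall fun ω => (hratio r ω).symm)
    refine Integrable.of_bound (hm.mono_ac (hac r)).aestronglyMeasurable 1 ?_
    filter_upwards [(hac r).ae_le (hr01 r)] with ω hω
    rw [Real.norm_of_nonneg hω.1]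
    exact hω.2
  have hbound : ∀ δ > 0, ∀ᶠ r in atTop, eps r < 1 →
      ∫ ω, ratio r ω ∂(condLaw r) ≤ 1 / (1 - eps r) * (orderStatBound C K + δ) := by
    intro δ hδ
    filter_upwards [eventually_exists_survival_event hKC hK ebar hUC hδ] with r hr hε
    obtain ⟨W, hW1, hW2⟩ := hr
    have h1 := hint r hε
    have hε' := hε
    rw [hcondLaw] at h1 ⊢
    rw [heps] at hε' ⊢
    refine (integral_cond_pos_le (hE r) hε' h1 (W := W) ?_).trans
      (mul_le_mul_of_nonneg_left hW2 (one_div_nonneg.2 (sub_nonneg.2 hε'.le)))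
    filter_upwards [hr01 r, hW1] with ω h01 hω
    by_cases h0 : (withTypes K (r * K) ebar ω).longTermEngagement (UC r ω) = 0
    · rw [hratio, h0, zero_div]
      exact Set.indicator_nonneg (fun _ _ => zero_le_one) ω
    · rw [Set.indicator_of_mem (subset_toMeasurable _ _ (hω h0))]
      exact h01.2
  refine ⟨fun r hr => ⟨hprob r hr, hint r hr⟩, hbound, fun hlim => ?_, orderStatBound_eq hCK hKC⟩
  refine limsup_le_of_eventually_le_mul (orderStatBound_nonneg C K)
    (fun r => ?_) (fun r => ?_) hbound hlim
  · rw [heps]; exact measureReal_le_one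
  -- Absolute continuity of `condLaw r` holds for every r, so this also covers `eps r = 1`.
  · exact integral_nonneg_of_ae ((hac r).ae_le ((hr01 r).mono fun ω h => h.1))
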